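/- Let $\mathcal{C}$ be a monoidal category that has coequalizers of reflexive pairs, such that $A\otimes(-)$ and $(-)\otimes A$ preserve these coequalizers for every object $A$. Let $M$ be a commutative central monoid, i.e. a commutative monoid in the Drinfeld center $\mathcal{Z}(\mathcal{C})$, with multiplication $m$, unit $1_M\colon \mathbb{1}\to M$ and half-braiding $s_B\colon M\otimes B\to B\otimes M$. (Associativity and unit isomorphisms of $\mathcal C$ are suppressed.) Let $\mathrm{Mod}_{\mathcal C}(M)$ be the category of right $M$-modules $X=(A,\mathrm{act}^A)$ in $\mathcal{C}$. It is monoidal with unit $M$ and relative tensor product $X\otimes_M Y$, where for $Y=(B,\mathrm{act}^B)$ the underlying object is the coequalizer of $\mathrm{act}^A\otimes B$ and $A\otimes(\mathrm{act}^B\, s_B)\colon A\otimes M\otimes B\rightrightarrows A\otimes B$, with the action induced by $A\otimes \mathrm{act}^B$. The forgetful functor $\mathrm{Forg}\colon \mathrm{Mod}_{\mathcal C}(M)\to\mathcal{C}$ is lax monoidal, with structure maps the quotient maps $A\otimes B\to A\otimes_M B$ and the unit $1_M$; its left adjoint is $\mathrm{Free}(B)=(B\otimes M, B\otimes m)$.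 1. For all $B$ in $\mathcal{C}$ and $X$ in $\mathrm{Mod}_{\mathcal C}(M)$, the morphisms $\mathrm{proj}^l_{B,X}\colon B\otimes\mathrm{Forg}(X)\to\mathrm{Forg}(\mathrm{Free}(B)\otimes_M X)$ and $\mathrm{proj}^r_{X,B}\colon \mathrm{Forg}(X)\otimes B\to\mathrm{Forg}(X\otimes_M\mathrm{Free}(B))$, each given by the unit of $\mathrm{Free}\dashv\mathrm{Forg}$ followed by the lax monoidal structure of $\mathrm{Forg}$, are isomorphisms. The assignment $$\mathcal{Z}(\mathrm{Forg})(X,c)=(\mathrm{Forg}(X),\overline{c}),\qquad \overline{c}_B=(\mathrm{proj}^l_{B,X})^{-1}\circ\mathrm{Forg}(c_{\mathrm{Free}(B)})\circ \mathrm{proj}^r_{X,B},\qquad f\mapsto\mathrm{Forg}(f),$$ is a well-defined functor $\mathcal{Z}(\mathrm{Mod}_{\mathcal C}(M))\to\mathcal{Z}(\mathcal{C})$, and it is braided lax monoidal with the structure maps of $\mathrm{Forg}$. 2. Let $\mathrm{Mod}^{\mathrm{loc}}_{\mathcal{Z}(\mathcal{C})}(M)$ be the braided monoidal category of local right $M$-modules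 in $\mathcal{Z}(\mathcal{C})$, that is, right $M$-modules $(A,\mathrm{act})$ in $\mathcal{Z}(\mathcal{C})$ with $\mathrm{act}\circ\Psi_{M,A}\circ\Psi_{A,M}=\mathrm{act}$, where $\Psi$ is the braiding of $\mathcal{Z}(\mathcal{C})$; its tensor product is $\otimes_M$ and its braiding is induced by $\Psi$. Let $\mathrm{Forg}^{\mathrm{loc}}\colon\mathrm{Mod}^{\mathrm{loc}}_{\mathcal{Z}(\mathcal{C})}(M)\to\mathcal{Z}(\mathcal{C})$ be the lax monoidal functor that forgets the $M$-action. There is an equivalence of braided monoidal categories (Schauenburg's equivalence) $$S\colon\mathcal{Z}(\mathrm{Mod}_{\mathcal C}(M))\xrightarrow{\ \sim\ }\mathrm{Mod}^{\mathrm{loc}}_{\mathcal{Z}(\mathcal{C})}(M)$$ that, up to natural isomorphism, sends $(X,c)$ with $X=(A,\mathrm{act})$ to $((A,\overline{c}),\mathrm{act})$ and is the identity on underlying morphisms. Under $S$, the functor $\mathcal{Z}(\mathrm{Forg})$ corresponds to $\mathrm{Forg}^{\mathrm{loc}}$. Precisely: there are a natural isomorphism $\varphi$ from $S$, followed by the functor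 to $\mathrm{Mod}_{\mathcal C}(M)$ that forgets the half-braiding, to the forgetful functor $\mathcal{Z}(\mathrm{Mod}_{\mathcal C}(M))\to\mathrm{Mod}_{\mathcal C}(M)$, and a monoidal natural isomorphism $\psi\colon\mathrm{Forg}^{\mathrm{loc}}\circ S\cong\mathcal{Z}(\mathrm{Forg})$, such that $\varphi$ and $\psi$ have the same underlying morphisms in $\mathcal{C}$. -/

import Mathlib

open CategoryTheory MonoidalCategory Limits MonObj

universe v u

set_option linter.unusedSectionVars false
set_option linter.unusedSimpArgs false

namespace LocalModules

section Modules

variable {C : Type u} [Category.{v} C] [MonoidalCategory C]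

/-- A half-braiding `swap` on a monoid `M` that makes it a commutative central monoid: unit and
multiplication are compatible with `swap`, and `M` is commutative with respect to `swap`. -/
class CentralCommMon (M : C) [MonObj M] where
  swap : HalfBraiding M
  one_swap : ∀ A : C, η[M] ▷ A ≫ (swap.β A).hom = (λ_ A).hom ≫ (ρ_ A).inv ≫ A ◁ η[M]
  mul_swap : ∀ A : C, μ[M] ▷ A ≫ (swap.β A).hom =
    (α_ M M A).hom ≫ M ◁ (swap.β A).hom ≫ (α_ M A M).inv ≫ (swap.β A).hom ▷ M ≫
      (α_ A M M).hom ≫ A ◁ μ[M]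
  swap_mul : (swap.β M).hom ≫ μ[M] = μ[M]

/-- Right modules over a monoid `M`, i.e. algebras over the monad `- ⊗ M`. -/
structure RMod (M : C) [MonObj M] where
  X : C
  act : X ⊗ M ⟶ X
  act_one : X ◁ η[M] ≫ act = (ρ_ X).hom
  act_mul : X ◁ μ[M] ≫ act = (α_ X M M).inv ≫ act ▷ M ≫ act

namespace RMod

variable {M : C} [MonObj M]

/-- Morphisms of right modules. -/
@[ext]
structure Hom (X Y : RMod M) where
  hom : X.X ⟶ Y.X
  comm : X.act ≫ hom = hom ▷ M ≫ Y.act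

instance : Category (RMod M) where
  Hom := Hom
  id X := ⟨𝟙 X.X, by simp⟩
  comp f g := ⟨f.hom ≫ g.hom, by simp [reassoc_of% f.comm, g.comm]⟩

@[ext]
theorem hom_ext {X Y : RMod M} {f g : X ⟶ Y} (h : f.hom = g.hom) : f = g := Hom.ext h

@[simp] theorem id_hom (X : RMod M) : Hom.hom (𝟙 X) = 𝟙 X.X := rfl
@[simp] theorem comp_hom {X Y Z : RMod M} (f : X ⟶ Y) (g : Y ⟶ Z) :
    (f ≫ g).hom = f.hom ≫ g.hom := rfl

theorem hom_comm {X Y : RMod M} (f : X ⟶ Y) : X.act ≫ f.hom = f.hom ▷ M ≫ Y.act := f.comm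

/-- A module map with invertible underlying map is an isomorphism. -/
def isoMk {X Y : RMod M} (e : X.X ≅ Y.X) (h : X.act ≫ e.hom = e.hom ▷ M ≫ Y.act) : X ≅ Y where
  hom := ⟨e.hom, h⟩
  inv := ⟨e.inv, by
    rw [← cancel_epi (e.hom ▷ M), ← cancel_mono e.hom]; simp [← h]⟩
  hom_inv_id := by ext; simp
  inv_hom_id := by ext; simp

variable (M) in
/-- The functor forgetting the action. -/
def forget : RMod M ⥤ C where
  obj X := X.X
  map f := f.hom

/-- The monoid as a right module over itself. -/
abbrev unit (M : C) [MonObj M] : RMod M where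
  X := M
  act := μ[M]
  act_one := by simp
  act_mul := by simp

variable (M) in
/-- The free module functor `B ↦ (B ⊗ M, B ⊗ mul)`. -/
def free : C ⥤ RMod M where
  obj B :=
    { X := B ⊗ M
      act := (α_ B M M).hom ≫ B ◁ μ[M]
      act_one := by
        simp [← MonoidalCategory.whiskerLeft_comp]
      act_mul := by
        simp [← MonoidalCategory.whiskerLeft_comp]  }
  map f := ⟨f ▷ M, by simp [whisker_exchange]⟩
  map_id _ := by ext; simp
  map_comp _ _ := by ext; simp

/-- The free-forgetful adjunction. -/
def adj (M : C) [MonObj M] : free M ⊣ forget M :=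
  Adjunction.mkOfUnitCounit
    { unit := { app := fun B => (ρ_ B).inv ≫ B ◁ η[M]
                naturality := by
                  intro A B f
                  simp [forget, free, whisker_exchange] }
      counit := { app := fun X => ⟨X.act, by simp [free, forget, X.act_mul]⟩
                  naturality := by
                    intro X Y f
                    ext
                    simp [forget, free, hom_comm] }
      left_triangle := by
        ext B
        simp [forget, free, ← MonoidalCategory.whiskerLeft_comp]
      right_triangle := by
        ext X
        simp [forget, free, X.act_one] }

theorem act_act (X : RMod M) :
    X.act ▷ M ≫ X.act = (α_ X.X M M).hom ≫ X.X ◁ μ[M] ≫ X.act := by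
  rw [X.act_mul]; simp

section Left

variable [CentralCommMon M]

/-- The half-braiding of the commutative central monoid. -/
abbrev sw (A : C) : M ⊗ A ≅ A ⊗ M := (CentralCommMon.swap (M := M)).β A

/-- The left action `M ⊗ X → X ⊗ M → X` obtained from the half-braiding of `M`. -/
def lact (X : RMod M) : M ⊗ X.X ⟶ X.X := (sw X.X).hom ≫ X.act

theorem sw_nat {A B : C} (f : A ⟶ B) : M ◁ f ≫ (sw B).hom = (sw A).hom ≫ f ▷ M :=
  HalfBraiding.naturality _ f

theorem sw_nat_assoc {A B : C} (f : A ⟶ B)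
    {W_ : C} (k_ : B ⊗ M ⟶ W_) :
    M ◁ f ≫ (sw B).hom ≫ k_ =
      (sw A).hom ≫ f ▷ M ≫ k_ :=
  (reassoc_of% (sw_nat (M := M) f)) k_

theorem sw_tensor (A B : C) : (sw (M := M) (A ⊗ B)).hom =
    (α_ _ _ _).inv ≫ (sw A).hom ▷ B ≫ (α_ _ _ _).hom ≫ A ◁ (sw B).hom ≫ (α_ _ _ _).inv :=
  HalfBraiding.monoidal _ A B

theorem sw_tensor_assoc (A B : C)
    {W_ : C} (k_ : (A ⊗ B) ⊗ M ⟶ W_) :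
    (sw (A ⊗ B)).hom ≫ k_ =
      (α_ M A B).inv ≫ (sw A).hom ▷ B ≫ (α_ A M B).hom ≫ A ◁ (sw B).hom ≫ (α_ A B M).inv ≫ k_ :=
  (reassoc_of% (sw_tensor (M := M) A B)) k_

theorem lact_one (X : RMod M) : η[M] ▷ X.X ≫ lact X = (λ_ X.X).hom := by
  rw [lact, reassoc_of% CentralCommMon.one_swap X.X, X.act_one]; simp

theorem lact_hom {X Y : RMod M} (f : X ⟶ Y) : M ◁ f.hom ≫ lact Y = lact X ≫ f.hom := by
  simp [lact, sw_nat_assoc, hom_comm]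

/-- The two actions commute. -/
theorem lact_act (X : RMod M) :
    lact X ▷ M ≫ X.act = (α_ _ _ _).hom ≫ M ◁ X.act ≫ lact X := by
  have h2 : (sw M).hom ≫ μ[M] = μ[M] := CentralCommMon.swap_mul
  simp only [lact, comp_whiskerRight, Category.assoc]
  rw [sw_nat_assoc, sw_tensor]
  simp only [Category.assoc, Iso.hom_inv_id_assoc]
  have h3 : X.act ▷ M ≫ X.act = (α_ X.X M M).hom ≫ X.X ◁ μ[M] ≫ X.act := by
    rw [X.act_mul]; simp
  rw [h3]
  simp only [Iso.inv_hom_id_assoc]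
  rw [← MonoidalCategory.whiskerLeft_comp_assoc X.X (sw M).hom, h2]

theorem lact_mul (X : RMod M) :
    μ[M] ▷ X.X ≫ lact X = (α_ _ _ _).hom ≫ M ◁ lact X ≫ lact X := by
  have h := lact_act X
  rw [← Iso.inv_comp_eq] at h
  have h2 : M ◁ lact X ≫ lact X = M ◁ (sw X.X).hom ≫ (α_ _ _ _).inv ≫ lact X ▷ M ≫ X.act := by
    rw [h]; simp [lact]
  rw [h2, lact, reassoc_of% CentralCommMon.mul_swap X.X]
  simp only [comp_whiskerRight, Category.assoc, act_act]

/-! ### The relative tensor product -/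

/-- `act^A ⊗ B`. -/
def left (X Y : RMod M) : (X.X ⊗ M) ⊗ Y.X ⟶ X.X ⊗ Y.X := X.act ▷ Y.X

/-- `A ⊗ (act^B ∘ swap_B)`. -/
def right (X Y : RMod M) : (X.X ⊗ M) ⊗ Y.X ⟶ X.X ⊗ Y.X :=
  (α_ X.X M Y.X).hom ≫ X.X ◁ lact Y

instance isReflexivePair (X Y : RMod M) : IsReflexivePair (left X Y) (right X Y) :=
  IsReflexivePair.mk' (((ρ_ X.X).inv ≫ X.X ◁ η[M]) ▷ Y.X)
    (by simp [left, ← comp_whiskerRight, X.act_one])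
    (by simp [right, ← MonoidalCategory.whiskerLeft_comp, lact_one])

variable [HasReflexiveCoequalizers C]

/-- The object underlying `X ⊗_M Y`. -/
noncomputable def tens (X Y : RMod M) : C := coequalizer (left X Y) (right X Y)

/-- The projection `A ⊗ B ⟶ X ⊗_M Y`. -/
noncomputable def proj (X Y : RMod M) : X.X ⊗ Y.X ⟶ tens X Y :=
  coequalizer.π (left X Y) (right X Y)

theorem proj_condition (X Y : RMod M) :
    X.act ▷ Y.X ≫ proj X Y = (α_ X.X M Y.X).hom ≫ X.X ◁ lact Y ≫ proj X Y :=
  (coequalizer.condition (left X Y) (right X Y)).trans (Category.assoc _ _ _)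

variable [∀ A : C, Monad.PreservesColimitOfIsReflexivePair (tensorLeft A)]
  [∀ A : C, Monad.PreservesColimitOfIsReflexivePair (tensorRight A)]

/-- The projection tensored with an object on the right is a coequalizer. -/
noncomputable def isColimitR (X Y : RMod M) (Z : C) :=
  isColimitOfHasCoequalizerOfPreservesColimit (tensorRight Z) (left X Y) (right X Y)

/-- The projection tensored with an object on the left is a coequalizer. -/
noncomputable def isColimitL (X Y : RMod M) (Z : C) :=
  isColimitOfHasCoequalizerOfPreservesColimit (tensorLeft Z) (left X Y) (right X Y)

theorem epi_projR (X Y : RMod M) (Z : C) : Epi (proj X Y ▷ Z) :=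
  ⟨fun _ _ h => Cofork.IsColimit.hom_ext (isColimitR X Y Z) h⟩

theorem epi_projL (X Y : RMod M) (Z : C) : Epi (Z ◁ proj X Y) :=
  ⟨fun _ _ h => Cofork.IsColimit.hom_ext (isColimitL X Y Z) h⟩

theorem exists_descR {X Y : RMod M} {Z W : C} (k : (X.X ⊗ Y.X) ⊗ Z ⟶ W)
    (h : X.act ▷ Y.X ▷ Z ≫ k = (α_ X.X M Y.X).hom ▷ Z ≫ (X.X ◁ lact Y) ▷ Z ≫ k) :
    ∃ l : tens X Y ⊗ Z ⟶ W, proj X Y ▷ Z ≫ l = k :=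
  ⟨_, (Cofork.IsColimit.desc' (isColimitR X Y Z) k (h.trans (by simp [right]))).2⟩

theorem exists_descL {X Y : RMod M} {Z W : C} (k : Z ⊗ (X.X ⊗ Y.X) ⟶ W)
    (h : Z ◁ X.act ▷ Y.X ≫ k = Z ◁ (α_ X.X M Y.X).hom ≫ Z ◁ X.X ◁ lact Y ≫ k) :
    ∃ l : Z ⊗ tens X Y ⟶ W, Z ◁ proj X Y ≫ l = k :=
  ⟨_, (Cofork.IsColimit.desc' (isColimitL X Y Z) k (h.trans (by simp [right]))).2⟩

theorem exists_act (X Y : RMod M) : ∃ a : tens X Y ⊗ M ⟶ tens X Y,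
    proj X Y ▷ M ≫ a = (α_ X.X Y.X M).hom ≫ X.X ◁ Y.act ≫ proj X Y :=
  exists_descR _ (by
    rw [associator_naturality_left_assoc, ← whisker_exchange_assoc, proj_condition,
      associator_naturality_middle_assoc, ← MonoidalCategory.whiskerLeft_comp_assoc, lact_act]
    simp)

/-- The right action on `X ⊗_M Y`: the factorization of `A ⊗ act^B` through the projection. -/
noncomputable def tensAct (X Y : RMod M) : tens X Y ⊗ M ⟶ tens X Y := (exists_act X Y).choose

theorem proj_tensAct (X Y : RMod M) :
    proj X Y ▷ M ≫ tensAct X Y = (α_ X.X Y.X M).hom ≫ X.X ◁ Y.act ≫ proj X Y :=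
  (exists_act X Y).choose_spec

/-- The relative tensor product of right modules. -/
noncomputable def tensorObj (X Y : RMod M) : RMod M where
  X := tens X Y
  act := tensAct X Y
  act_one := by
    have := epi_projR X Y (𝟙_ C)
    rw [← cancel_epi (proj X Y ▷ 𝟙_ C), ← whisker_exchange_assoc, proj_tensAct,
      rightUnitor_naturality, associator_naturality_right_assoc,
      ← MonoidalCategory.whiskerLeft_comp_assoc, Y.act_one]
    simp
  act_mul := by
    have := epi_projR X Y (M ⊗ M)
    rw [← cancel_epi (proj X Y ▷ (M ⊗ M)), ← whisker_exchange_assoc, proj_tensAct,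
      associator_inv_naturality_left_assoc, ← comp_whiskerRight_assoc, proj_tensAct]
    simp only [comp_whiskerRight, Category.assoc, proj_tensAct]
    rw [associator_naturality_middle_assoc, associator_naturality_right_assoc,
      ← MonoidalCategory.whiskerLeft_comp_assoc, Y.act_mul]
    simp

/-- The projection `A ⊗ B ⟶ X ⊗_M Y` onto the relative tensor product. -/
noncomputable def quo (X Y : RMod M) : X.X ⊗ Y.X ⟶ (tensorObj X Y).X := proj X Y

theorem quo_condition (X Y : RMod M) :
    X.act ▷ Y.X ≫ quo X Y = (α_ X.X M Y.X).hom ≫ X.X ◁ lact Y ≫ quo X Y := proj_condition X Y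

instance epi_quo (X Y : RMod M) : Epi (quo X Y) :=
  inferInstanceAs (Epi (coequalizer.π (left X Y) (right X Y)))

instance epi_quoR (X Y : RMod M) (Z : C) : Epi (quo X Y ▷ Z) := epi_projR X Y Z

instance epi_quoL (X Y : RMod M) (Z : C) : Epi (Z ◁ quo X Y) := epi_projL X Y Z

instance epi_quoRR (X Y : RMod M) (Z W : C) : Epi (quo X Y ▷ Z ▷ W) := by
  have : quo X Y ▷ Z ▷ W = (α_ _ _ _).hom ≫ quo X Y ▷ (Z ⊗ W) ≫ (α_ _ _ _).inv := by simp
  rw [this]; infer_instance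

/-- Descent along the projection. -/
noncomputable def desc {X Y : RMod M} {W : C} (k : X.X ⊗ Y.X ⟶ W)
    (h : X.act ▷ Y.X ≫ k = (α_ X.X M Y.X).hom ≫ X.X ◁ lact Y ≫ k) : (tensorObj X Y).X ⟶ W :=
  coequalizer.desc (f := left X Y) (g := right X Y) k (h.trans (by simp [right]))

@[simp]
theorem quo_desc {X Y : RMod M} {W : C} (k : X.X ⊗ Y.X ⟶ W)
    (h : X.act ▷ Y.X ≫ k = (α_ X.X M Y.X).hom ≫ X.X ◁ lact Y ≫ k) :
    quo X Y ≫ desc k h = k := coequalizer.π_desc _ _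

@[simp] theorem quo_desc_assoc {X Y : RMod M} {W : C} (k : X.X ⊗ Y.X ⟶ W)
    (h : X.act ▷ Y.X ≫ k = (α_ X.X M Y.X).hom ≫ X.X ◁ lact Y ≫ k)
    {W_ : C} (k_ : W ⟶ W_) :
    quo X Y ≫ desc k h ≫ k_ =
      k ≫ k_ :=
  by rw [← Category.assoc, quo_desc]

/-- Descent along `quo ⊗ Z`. -/
noncomputable def descR {X Y : RMod M} {Z W : C} (k : (X.X ⊗ Y.X) ⊗ Z ⟶ W)
    (h : X.act ▷ Y.X ▷ Z ≫ k = (α_ X.X M Y.X).hom ▷ Z ≫ (X.X ◁ lact Y) ▷ Z ≫ k) :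
    (tensorObj X Y).X ⊗ Z ⟶ W := (exists_descR k h).choose

@[simp]
theorem quo_descR {X Y : RMod M} {Z W : C} (k : (X.X ⊗ Y.X) ⊗ Z ⟶ W)
    (h : X.act ▷ Y.X ▷ Z ≫ k = (α_ X.X M Y.X).hom ▷ Z ≫ (X.X ◁ lact Y) ▷ Z ≫ k) :
    quo X Y ▷ Z ≫ descR k h = k := (exists_descR k h).choose_spec

/-- Descent along `Z ⊗ quo`. -/
noncomputable def descL {X Y : RMod M} {Z W : C} (k : Z ⊗ (X.X ⊗ Y.X) ⟶ W)
    (h : Z ◁ X.act ▷ Y.X ≫ k = Z ◁ (α_ X.X M Y.X).hom ≫ Z ◁ X.X ◁ lact Y ≫ k) :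
    Z ⊗ (tensorObj X Y).X ⟶ W := (exists_descL k h).choose

@[simp]
theorem quo_descL {X Y : RMod M} {Z W : C} (k : Z ⊗ (X.X ⊗ Y.X) ⟶ W)
    (h : Z ◁ X.act ▷ Y.X ≫ k = Z ◁ (α_ X.X M Y.X).hom ≫ Z ◁ X.X ◁ lact Y ≫ k) :
    Z ◁ quo X Y ≫ descL k h = k := (exists_descL k h).choose_spec

theorem quo_act (X Y : RMod M) :
    quo X Y ▷ M ≫ (tensorObj X Y).act = (α_ X.X Y.X M).hom ≫ X.X ◁ Y.act ≫ quo X Y :=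
  proj_tensAct X Y

theorem quo_act_assoc (X Y : RMod M)
    {W_ : C} (k_ : (tensorObj X Y).X ⟶ W_) :
    quo X Y ▷ M ≫ (tensorObj X Y).act ≫ k_ =
      (α_ X.X Y.X M).hom ≫ X.X ◁ Y.act ≫ quo X Y ≫ k_ :=
  (reassoc_of% (quo_act X Y)) k_

theorem quo_lact (X Y : RMod M) :
    M ◁ quo X Y ≫ lact (tensorObj X Y) = (α_ _ _ _).inv ≫ lact X ▷ Y.X ≫ quo X Y := by
  rw [lact, sw_nat_assoc, quo_act, sw_tensor_assoc]
  simp only [Iso.inv_hom_id_assoc]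
  rw [← MonoidalCategory.whiskerLeft_comp_assoc, ← lact, ← quo_condition]
  simp [lact]

/-- The relative tensor product of morphisms. -/
noncomputable def tensorHom {X₁ Y₁ X₂ Y₂ : RMod M} (f : X₁ ⟶ Y₁) (g : X₂ ⟶ Y₂) :
    tensorObj X₁ X₂ ⟶ tensorObj Y₁ Y₂ where
  hom := desc (f.hom ▷ X₂.X ≫ Y₁.X ◁ g.hom ≫ quo Y₁ Y₂) (by
    rw [← comp_whiskerRight_assoc, hom_comm, comp_whiskerRight_assoc, ← whisker_exchange_assoc,
      quo_condition, whisker_exchange_assoc, associator_naturality_right_assoc,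
      ← MonoidalCategory.whiskerLeft_comp_assoc, lact_hom, associator_naturality_left_assoc]
    simp [whisker_exchange_assoc])
  comm := by
    rw [← cancel_epi (quo X₁ X₂ ▷ M), quo_act_assoc, quo_desc, ← comp_whiskerRight_assoc,
      quo_desc]
    simp only [comp_whiskerRight, Category.assoc, quo_act]
    rw [associator_naturality_middle_assoc, ← MonoidalCategory.whiskerLeft_comp_assoc, ← hom_comm,
      associator_naturality_left_assoc, ← whisker_exchange_assoc]
    simp only [MonoidalCategory.whiskerLeft_comp, Category.assoc, whisker_exchange_assoc]

@[simp]
theorem quo_tensorHom {X₁ Y₁ X₂ Y₂ : RMod M} (f : X₁ ⟶ Y₁) (g : X₂ ⟶ Y₂) :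
    quo X₁ X₂ ≫ (tensorHom f g).hom = f.hom ▷ X₂.X ≫ Y₁.X ◁ g.hom ≫ quo Y₁ Y₂ := by
  dsimp only [tensorHom]; rw [quo_desc]

@[simp] theorem quo_tensorHom_assoc {X₁ Y₁ X₂ Y₂ : RMod M} (f : X₁ ⟶ Y₁) (g : X₂ ⟶ Y₂)
    {W_ : C} (k_ : (tensorObj Y₁ Y₂).X ⟶ W_) :
    quo X₁ X₂ ≫ (tensorHom f g).hom ≫ k_ =
      f.hom ▷ X₂.X ≫ Y₁.X ◁ g.hom ≫ quo Y₁ Y₂ ≫ k_ :=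
  (reassoc_of% (quo_tensorHom f g)) k_

/-! ### Associator and unitors -/

/-- The map `(A ⊗ B) ⊗ D ⟶ X ⊗_M (Y ⊗_M Z)`. -/
noncomputable def assocAux (X Y Z : RMod M) : (X.X ⊗ Y.X) ⊗ Z.X ⟶ (tensorObj X (tensorObj Y Z)).X :=
  (α_ X.X Y.X Z.X).hom ≫ X.X ◁ quo Y Z ≫ quo X (tensorObj Y Z)

theorem assocAux_left (X Y Z : RMod M) :
    X.act ▷ Y.X ▷ Z.X ≫ assocAux X Y Z =
      (α_ X.X M Y.X).hom ▷ Z.X ≫ (X.X ◁ lact Y) ▷ Z.X ≫ assocAux X Y Z := by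
  rw [assocAux, associator_naturality_left_assoc, ← whisker_exchange_assoc, quo_condition,
    associator_naturality_right_assoc, ← MonoidalCategory.whiskerLeft_comp_assoc, quo_lact]
  simp

/-- The map `(X ⊗_M Y) ⊗ D ⟶ X ⊗_M (Y ⊗_M Z)`. -/
noncomputable def assocAux' (X Y Z : RMod M) :
    (tensorObj X Y).X ⊗ Z.X ⟶ (tensorObj X (tensorObj Y Z)).X :=
  descR (assocAux X Y Z) (assocAux_left X Y Z)

theorem quo_assocAux' (X Y Z : RMod M) :
    quo X Y ▷ Z.X ≫ assocAux' X Y Z =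
      (α_ X.X Y.X Z.X).hom ≫ X.X ◁ quo Y Z ≫ quo X (tensorObj Y Z) := quo_descR _ _

/-- The underlying morphism of the associator. -/
noncomputable def assocHom (X Y Z : RMod M) :
    (tensorObj (tensorObj X Y) Z).X ⟶ (tensorObj X (tensorObj Y Z)).X :=
  desc (assocAux' X Y Z) (by
    rw [← cancel_epi (quo X Y ▷ M ▷ Z.X), ← comp_whiskerRight_assoc, quo_act,
      associator_naturality_left_assoc, ← whisker_exchange_assoc, quo_assocAux']
    simp only [comp_whiskerRight, Category.assoc, quo_assocAux']
    rw [associator_naturality_middle_assoc, ← MonoidalCategory.whiskerLeft_comp_assoc,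
      quo_condition]
    simp)

theorem quo_quo_assocHom (X Y Z : RMod M) :
    quo X Y ▷ Z.X ≫ quo (tensorObj X Y) Z ≫ assocHom X Y Z =
      (α_ X.X Y.X Z.X).hom ≫ X.X ◁ quo Y Z ≫ quo X (tensorObj Y Z) := by
  rw [assocHom, quo_desc, quo_assocAux']

theorem quo_quo_assocHom_assoc (X Y Z : RMod M)
    {W_ : C} (k_ : (tensorObj X (tensorObj Y Z)).X ⟶ W_) :
    quo X Y ▷ Z.X ≫ quo (tensorObj X Y) Z ≫ assocHom X Y Z ≫ k_ =
      (α_ X.X Y.X Z.X).hom ≫ X.X ◁ quo Y Z ≫ quo X (tensorObj Y Z) ≫ k_ :=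
  (reassoc_of% (quo_quo_assocHom X Y Z)) k_

/-- The map `A ⊗ (Y ⊗_M Z) ⟶ (X ⊗_M Y) ⊗_M Z`. -/
noncomputable def assocInvAux (X Y Z : RMod M) :
    X.X ⊗ (tensorObj Y Z).X ⟶ (tensorObj (tensorObj X Y) Z).X :=
  descL ((α_ X.X Y.X Z.X).inv ≫ quo X Y ▷ Z.X ≫ quo (tensorObj X Y) Z) (by
    rw [associator_inv_naturality_middle_assoc, ← reassoc_of% (comp_whiskerRight _ _ Z.X)]
    have h := quo_act X Y
    rw [← Iso.inv_comp_eq] at h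
    rw [← h]
    simp only [comp_whiskerRight, Category.assoc, quo_condition]
    rw [associator_naturality_left_assoc, ← whisker_exchange_assoc]
    simp)

theorem quo_assocInvAux (X Y Z : RMod M) :
    X.X ◁ quo Y Z ≫ assocInvAux X Y Z =
      (α_ X.X Y.X Z.X).inv ≫ quo X Y ▷ Z.X ≫ quo (tensorObj X Y) Z := quo_descL _ _

/-- The underlying morphism of the inverse of the associator. -/
noncomputable def assocInv (X Y Z : RMod M) :
    (tensorObj X (tensorObj Y Z)).X ⟶ (tensorObj (tensorObj X Y) Z).X :=
  desc (assocInvAux X Y Z) (by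
    rw [← cancel_epi ((X.X ⊗ M) ◁ quo Y Z), whisker_exchange_assoc, quo_assocInvAux,
      associator_naturality_right_assoc, ← MonoidalCategory.whiskerLeft_comp_assoc, quo_lact]
    simp only [MonoidalCategory.whiskerLeft_comp, Category.assoc, quo_assocInvAux]
    rw [associator_inv_naturality_left_assoc, ← comp_whiskerRight_assoc, quo_condition]
    simp)

theorem quo_quo_assocInv (X Y Z : RMod M) :
    X.X ◁ quo Y Z ≫ quo X (tensorObj Y Z) ≫ assocInv X Y Z =
      (α_ X.X Y.X Z.X).inv ≫ quo X Y ▷ Z.X ≫ quo (tensorObj X Y) Z := by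
  rw [assocInv, quo_desc, quo_assocInvAux]

theorem quo_quo_assocInv_assoc (X Y Z : RMod M)
    {W_ : C} (k_ : (tensorObj (tensorObj X Y) Z).X ⟶ W_) :
    X.X ◁ quo Y Z ≫ quo X (tensorObj Y Z) ≫ assocInv X Y Z ≫ k_ =
      (α_ X.X Y.X Z.X).inv ≫ quo X Y ▷ Z.X ≫ quo (tensorObj X Y) Z ≫ k_ :=
  (reassoc_of% (quo_quo_assocInv X Y Z)) k_

/-- The associator. -/
noncomputable def associator (X Y Z : RMod M) :
    tensorObj (tensorObj X Y) Z ≅ tensorObj X (tensorObj Y Z) :=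
  isoMk
    { hom := assocHom X Y Z
      inv := assocInv X Y Z
      hom_inv_id := by
        rw [← cancel_epi (quo (tensorObj X Y) Z), ← cancel_epi (quo X Y ▷ Z.X),
          quo_quo_assocHom_assoc, quo_quo_assocInv]
        simp
      inv_hom_id := by
        rw [← cancel_epi (quo X (tensorObj Y Z)), ← cancel_epi (X.X ◁ quo Y Z),
          quo_quo_assocInv_assoc, quo_quo_assocHom]
        simp }
    (by
      dsimp only
      rw [← cancel_epi (quo (tensorObj X Y) Z ▷ M), ← cancel_epi (quo X Y ▷ Z.X ▷ M)]
      rw [quo_act_assoc, associator_naturality_left_assoc, ← whisker_exchange_assoc,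
        quo_quo_assocHom]
      rw [← comp_whiskerRight_assoc, ← comp_whiskerRight_assoc, Category.assoc, quo_quo_assocHom]
      simp only [comp_whiskerRight, Category.assoc, quo_act]
      rw [associator_naturality_middle_assoc, ← MonoidalCategory.whiskerLeft_comp_assoc, quo_act]
      simp)

theorem quo_quo_associator (X Y Z : RMod M) :
    quo X Y ▷ Z.X ≫ quo (tensorObj X Y) Z ≫ (associator X Y Z).hom.hom =
      (α_ X.X Y.X Z.X).hom ≫ X.X ◁ quo Y Z ≫ quo X (tensorObj Y Z) := quo_quo_assocHom X Y Z

theorem quo_quo_associator_assoc (X Y Z : RMod M)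
    {W_ : C} (k_ : (tensorObj X (tensorObj Y Z)).X ⟶ W_) :
    quo X Y ▷ Z.X ≫ quo (tensorObj X Y) Z ≫ (associator X Y Z).hom.hom ≫ k_ =
      (α_ X.X Y.X Z.X).hom ≫ X.X ◁ quo Y Z ≫ quo X (tensorObj Y Z) ≫ k_ :=
  (reassoc_of% (quo_quo_associator X Y Z)) k_

/-- The left unitor, induced by the left action. -/
noncomputable def leftUnitor (X : RMod M) : tensorObj (unit M) X ≅ X :=
  isoMk
    { hom := desc (X := unit M) (lact X) (lact_mul X)
      inv := (λ_ X.X).inv ≫ η[M] ▷ X.X ≫ quo (unit M) X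
      hom_inv_id := by
        rw [← cancel_epi (quo (unit M) X), quo_desc_assoc, leftUnitor_inv_naturality_assoc,
          whisker_exchange_assoc]
        have h := quo_condition (unit M) X
        rw [← Iso.inv_comp_eq] at h
        have h' : M ◁ lact X ≫ quo (unit M) X = _ := h.symm
        erw [h']
        have : η[M] ▷ M ≫ μ[M] = (λ_ M).hom := MonObj.one_mul M
        simp [← comp_whiskerRight_assoc]
      inv_hom_id := by simp [unit, lact_one] }
    (by
      dsimp only
      rw [← cancel_epi (quo (unit M) X ▷ M), quo_act_assoc, quo_desc, ← comp_whiskerRight_assoc,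
        quo_desc, lact_act])

theorem quo_leftUnitor (X : RMod M) : quo (unit M) X ≫ (leftUnitor X).hom.hom = lact X := by
  dsimp only [leftUnitor, isoMk]; rw [quo_desc]

theorem quo_leftUnitor_assoc (X : RMod M)
    {W_ : C} (k_ : X.X ⟶ W_) :
    quo (unit M) X ≫ (leftUnitor X).hom.hom ≫ k_ =
      lact X ≫ k_ :=
  (reassoc_of% (quo_leftUnitor X)) k_

theorem lact_unit : lact (unit M) = μ[M] := CentralCommMon.swap_mul

/-- The right unitor, induced by the right action. -/
noncomputable def rightUnitor (X : RMod M) : tensorObj X (unit M) ≅ X :=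
  isoMk
    { hom := desc (Y := unit M) X.act (by rw [lact_unit]; exact act_act X)
      inv := (ρ_ X.X).inv ≫ X.X ◁ η[M] ≫ quo X (unit M)
      hom_inv_id := by
        rw [← cancel_epi (quo X (unit M)), quo_desc_assoc, rightUnitor_inv_naturality_assoc,
          ← whisker_exchange_assoc]
        have h : X.act ▷ M ≫ quo X (unit M) = (α_ X.X M M).hom ≫ X.X ◁ μ[M] ≫ quo X (unit M) := by
          have := quo_condition X (unit M)
          rwa [lact_unit] at this
        erw [h]
        simp [unit, ← MonoidalCategory.whiskerLeft_comp_assoc]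
      inv_hom_id := by simp [unit, X.act_one] }
    (by
      dsimp only
      rw [← cancel_epi (quo X (unit M) ▷ M), quo_act_assoc, quo_desc, ← comp_whiskerRight_assoc,
        quo_desc]
      exact (act_act X).symm)

theorem quo_rightUnitor (X : RMod M) : quo X (unit M) ≫ (rightUnitor X).hom.hom = X.act := by
  dsimp only [rightUnitor, isoMk]; rw [quo_desc]

theorem quo_rightUnitor_assoc (X : RMod M)
    {W_ : C} (k_ : X.X ⟶ W_) :
    quo X (unit M) ≫ (rightUnitor X).hom.hom ≫ k_ =
      X.act ≫ k_ :=
  (reassoc_of% (quo_rightUnitor X)) k_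

noncomputable instance : MonoidalCategoryStruct (RMod M) where
  tensorObj := tensorObj
  tensorHom := tensorHom
  whiskerLeft X _ _ f := tensorHom (𝟙 X) f
  whiskerRight f Y := tensorHom f (𝟙 Y)
  tensorUnit := unit M
  associator := associator
  leftUnitor := leftUnitor
  rightUnitor := rightUnitor

theorem hom_ext_quo {X Y Z : RMod M} {f g : tensorObj X Y ⟶ Z}
    (h : quo X Y ≫ f.hom = quo X Y ≫ g.hom) : f = g :=
  hom_ext ((cancel_epi (quo X Y)).1 h)

theorem hom_ext_quo₃ {X Y Z W : RMod M} {f g : tensorObj (tensorObj X Y) Z ⟶ W}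
    (h : quo X Y ▷ Z.X ≫ quo (tensorObj X Y) Z ≫ f.hom =
      quo X Y ▷ Z.X ≫ quo (tensorObj X Y) Z ≫ g.hom) : f = g :=
  hom_ext_quo ((cancel_epi (quo X Y ▷ Z.X)).1 h)

theorem tensorHom_comp {X₁ Y₁ Z₁ X₂ Y₂ Z₂ : RMod M} (f₁ : X₁ ⟶ Y₁) (f₂ : X₂ ⟶ Y₂)
    (g₁ : Y₁ ⟶ Z₁) (g₂ : Y₂ ⟶ Z₂) :
    tensorHom f₁ f₂ ≫ tensorHom g₁ g₂ = tensorHom (f₁ ≫ g₁) (f₂ ≫ g₂) := by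
  apply hom_ext_quo
  simp [whisker_exchange_assoc]

theorem tensorHom_id_id (X Y : RMod M) : tensorHom (𝟙 X) (𝟙 Y) = 𝟙 (tensorObj X Y) := by
  apply hom_ext_quo
  simp

theorem assoc_naturality {X₁ X₂ X₃ Y₁ Y₂ Y₃ : RMod M} (f₁ : X₁ ⟶ Y₁) (f₂ : X₂ ⟶ Y₂)
    (f₃ : X₃ ⟶ Y₃) :
    tensorHom (tensorHom f₁ f₂) f₃ ≫ (associator Y₁ Y₂ Y₃).hom =
      (associator X₁ X₂ X₃).hom ≫ tensorHom f₁ (tensorHom f₂ f₃) := by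
  apply hom_ext_quo₃
  simp only [comp_hom, quo_tensorHom_assoc, quo_quo_associator_assoc]
  rw [← comp_whiskerRight_assoc, quo_tensorHom, quo_tensorHom,
    whisker_exchange_assoc, ← MonoidalCategory.whiskerLeft_comp_assoc, quo_tensorHom]
  simp only [comp_whiskerRight, Category.assoc, ← whisker_exchange_assoc,
    MonoidalCategory.whiskerLeft_comp, quo_quo_associator]
  simp [whisker_exchange_assoc]

theorem pentagon' (W X Y Z : RMod M) :
    tensorHom (associator W X Y).hom (𝟙 Z) ≫
        (associator W (tensorObj X Y) Z).hom ≫ tensorHom (𝟙 W) (associator X Y Z).hom =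
      (associator (tensorObj W X) Y Z).hom ≫ (associator W X (tensorObj Y Z)).hom := by
  apply hom_ext_quo₃
  rw [← cancel_epi (quo W X ▷ Y.X ▷ Z.X)]
  simp only [comp_hom, quo_tensorHom_assoc, id_hom, quo_quo_associator_assoc,
    MonoidalCategory.whiskerLeft_id, Category.id_comp]
  rw [← comp_whiskerRight_assoc, ← comp_whiskerRight_assoc, Category.assoc, quo_quo_associator]
  simp only [comp_whiskerRight, Category.assoc, quo_quo_associator_assoc, quo_tensorHom,
    id_hom, id_whiskerRight, Category.id_comp]
  rw [associator_naturality_middle_assoc, ← MonoidalCategory.whiskerLeft_comp_assoc,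
    ← MonoidalCategory.whiskerLeft_comp_assoc, Category.assoc, quo_quo_associator,
    associator_naturality_left_assoc, ← whisker_exchange_assoc, quo_quo_associator]
  simp

theorem triangle' (X Y : RMod M) :
    (associator X (unit M) Y).hom ≫ tensorHom (𝟙 X) (leftUnitor Y).hom =
      tensorHom (rightUnitor X).hom (𝟙 Y) := by
  apply hom_ext_quo₃
  simp only [comp_hom, quo_tensorHom, quo_quo_associator_assoc, id_hom,
    MonoidalCategory.whiskerLeft_id, Category.id_comp, id_whiskerRight]
  rw [← comp_whiskerRight_assoc, quo_rightUnitor, ← MonoidalCategory.whiskerLeft_comp_assoc,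
    quo_leftUnitor, quo_condition]

theorem leftUnitor_naturality' {X Y : RMod M} (f : X ⟶ Y) :
    tensorHom (𝟙 (unit M)) f ≫ (leftUnitor Y).hom = (leftUnitor X).hom ≫ f := by
  apply hom_ext_quo
  simp only [comp_hom, quo_tensorHom_assoc, quo_leftUnitor, quo_leftUnitor_assoc, id_hom,
    id_whiskerRight, Category.id_comp, lact_hom]

theorem rightUnitor_naturality' {X Y : RMod M} (f : X ⟶ Y) :
    tensorHom f (𝟙 (unit M)) ≫ (rightUnitor Y).hom = (rightUnitor X).hom ≫ f := by
  apply hom_ext_quo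
  simp only [comp_hom, quo_tensorHom_assoc, quo_rightUnitor, quo_rightUnitor_assoc, id_hom,
    MonoidalCategory.whiskerLeft_id, Category.id_comp, hom_comm]

/-- Right modules over a commutative central monoid form a monoidal category under `⊗_M`. -/
noncomputable instance monoidalCategory : MonoidalCategory (RMod M) :=
  MonoidalCategory.ofTensorHom
    (id_tensorHom_id := tensorHom_id_id)
    (id_tensorHom := fun _ _ _ _ => rfl)
    (tensorHom_id := fun _ _ => rfl)
    (tensorHom_comp_tensorHom := tensorHom_comp)
    (associator_naturality := assoc_naturality)
    (leftUnitor_naturality := leftUnitor_naturality')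
    (rightUnitor_naturality := rightUnitor_naturality')
    (pentagon := pentagon')
    (triangle := triangle')

theorem quo_natural_left {X Y : RMod M} (f : X ⟶ Y) (Z : RMod M) :
    f.hom ▷ Z.X ≫ quo Y Z = quo X Z ≫ (tensorHom f (𝟙 Z)).hom := by simp

theorem quo_natural_right (Z : RMod M) {X Y : RMod M} (f : X ⟶ Y) :
    Z.X ◁ f.hom ≫ quo Z Y = quo Z X ≫ (tensorHom (𝟙 Z) f).hom := by simp

/-- The lax monoidal structure on the forgetful functor: the unit constraint is the unit of `M` and
the tensor constraint is `quo`. -/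
noncomputable instance forgetLaxMonoidal : (forget M).LaxMonoidal :=
  Functor.LaxMonoidal.mk η[M] (fun X Y => quo X Y)
    (fun f X => quo_natural_left f X)
    (fun X f => quo_natural_right X f)
    (fun X Y Z => quo_quo_associator X Y Z)
    (fun X => by
      have h := lact_one X
      rw [← quo_leftUnitor X] at h
      exact h.symm)
    (fun X => by
      have h := X.act_one
      rw [← quo_rightUnitor X] at h
      exact h.symm)

end Left

end RMod

end Modules

/-! ### Local modules in a braided category -/

section Local

variable {D : Type u} [Category.{v} D] [MonoidalCategory D] [BraidedCategory D]

/-- A commutative monoid in a braided category is central via the braiding. -/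
instance braidedCentralCommMon (M : D) [MonObj M] [IsCommMonObj M] : CentralCommMon M where
  swap := { β := fun A => β_ M A }
  one_swap A := by simp
  mul_swap A := by simp
  swap_mul := IsCommMonObj.mul_comm M

namespace RMod

/-- A right module `(A, act)` is local if `act ∘ Ψ_{M,A} ∘ Ψ_{A,M} = act`. -/
def isLocal (M : D) [MonObj M] : ObjectProperty (RMod M) := fun X =>
  (β_ X.X M).hom ≫ (β_ M X.X).hom ≫ X.act = X.act

variable {M : D} [MonObj M] [IsCommMonObj M]

theorem lact_eq (X : RMod M) : lact X = (β_ M X.X).hom ≫ X.act := rfl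

theorem braiding_lact {X : RMod M} (h : isLocal M X) : (β_ X.X M).hom ≫ lact X = X.act := h

theorem isLocal_of {X : RMod M} (h : (β_ X.X M).hom ≫ lact X = X.act) : isLocal M X := h

variable [HasReflexiveCoequalizers D]
  [∀ A : D, Monad.PreservesColimitOfIsReflexivePair (tensorLeft A)]
  [∀ A : D, Monad.PreservesColimitOfIsReflexivePair (tensorRight A)]

theorem isLocal_tensorObj {X Y : RMod M} (hX : isLocal M X) (hY : isLocal M Y) :
    isLocal M (tensorObj X Y) := by
  apply isLocal_of
  rw [← cancel_epi (quo X Y ▷ M), BraidedCategory.braiding_naturality_left_assoc, quo_lact,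
    quo_act, BraidedCategory.braiding_tensor_left_hom]
  simp only [Category.assoc, Iso.hom_inv_id_assoc]
  rw [← comp_whiskerRight_assoc, braiding_lact hX, quo_condition]
  simp only [Iso.inv_hom_id_assoc]
  rw [← MonoidalCategory.whiskerLeft_comp_assoc, braiding_lact hY]

instance isMonoidal_isLocal : (isLocal M).IsMonoidal where
  prop_unit := by
    apply isLocal_of
    rw [lact_eq]
    change (β_ M M).hom ≫ (β_ M M).hom ≫ μ[M] = μ[M]
    rw [IsCommMonObj.mul_comm, IsCommMonObj.mul_comm]
  prop_tensor _ _ h₁ h₂ := isLocal_tensorObj h₁ h₂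

/-- The braiding descends to the relative tensor product of local modules. -/
noncomputable def braidHom (X Y : RMod M) (hX : isLocal M X) :
    (tensorObj X Y).X ⟶ (tensorObj Y X).X :=
  desc ((β_ X.X Y.X).hom ≫ quo Y X) (by
    rw [BraidedCategory.braiding_naturality_left_assoc, lact_eq,
      MonoidalCategory.whiskerLeft_comp_assoc,
      BraidedCategory.braiding_naturality_right_assoc, quo_condition,
      BraidedCategory.braiding_tensor_left_hom, BraidedCategory.braiding_tensor_right_hom,
      ← braiding_lact hX]
    simp)

theorem quo_braidHom (X Y : RMod M) (hX : isLocal M X) :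
    quo X Y ≫ braidHom X Y hX = (β_ X.X Y.X).hom ≫ quo Y X := quo_desc _ _

theorem quo_braidHom_assoc (X Y : RMod M) (hX : isLocal M X)
    {W_ : D} (k_ : (tensorObj Y X).X ⟶ W_) :
    quo X Y ≫ braidHom X Y hX ≫ k_ =
      (β_ X.X Y.X).hom ≫ quo Y X ≫ k_ :=
  (reassoc_of% (quo_braidHom X Y hX)) k_

/-- The inverse of the braiding on the relative tensor product. -/
noncomputable def braidInv (X Y : RMod M) (hX : isLocal M X) :
    (tensorObj Y X).X ⟶ (tensorObj X Y).X :=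
  desc ((β_ X.X Y.X).inv ≫ quo X Y) (by
    rw [← cancel_epi (β_ X.X (Y.X ⊗ M)).hom, ← BraidedCategory.braiding_naturality_right_assoc,
      Iso.hom_inv_id_assoc, BraidedCategory.braiding_tensor_right_hom]
    simp only [Category.assoc, Iso.inv_hom_id_assoc]
    rw [← MonoidalCategory.whiskerLeft_comp_assoc, braiding_lact hX,
      BraidedCategory.braiding_inv_naturality_right_assoc, quo_condition, lact_eq,
      BraidedCategory.braiding_tensor_left_inv]
    simp)

theorem quo_braidInv (X Y : RMod M) (hX : isLocal M X) :
    quo Y X ≫ braidInv X Y hX = (β_ X.X Y.X).inv ≫ quo X Y := quo_desc _ _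

theorem quo_braidInv_assoc (X Y : RMod M) (hX : isLocal M X)
    {W_ : D} (k_ : (tensorObj X Y).X ⟶ W_) :
    quo Y X ≫ braidInv X Y hX ≫ k_ =
      (β_ X.X Y.X).inv ≫ quo X Y ≫ k_ :=
  (reassoc_of% (quo_braidInv X Y hX)) k_

/-- The braiding of a local module with a module. -/
noncomputable def braid (X Y : RMod M) (hX : isLocal M X) : tensorObj X Y ≅ tensorObj Y X :=
  isoMk
    { hom := braidHom X Y hX
      inv := braidInv X Y hX
      hom_inv_id := by
        rw [← cancel_epi (quo X Y), quo_braidHom_assoc, quo_braidInv]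
        simp
      inv_hom_id := by
        rw [← cancel_epi (quo Y X), quo_braidInv_assoc, quo_braidHom]
        simp }
    (by
      dsimp only
      rw [← cancel_epi (quo X Y ▷ M), quo_act_assoc, quo_braidHom, ← comp_whiskerRight_assoc,
        quo_braidHom]
      simp only [comp_whiskerRight, Category.assoc, quo_act]
      rw [BraidedCategory.braiding_naturality_right_assoc, quo_condition,
        BraidedCategory.braiding_tensor_right_hom, ← braiding_lact hX]
      simp)

theorem quo_braid (X Y : RMod M) (hX : isLocal M X) :
    quo X Y ≫ (braid X Y hX).hom.hom = (β_ X.X Y.X).hom ≫ quo Y X := quo_braidHom X Y hX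

theorem quo_braid_assoc (X Y : RMod M) (hX : isLocal M X)
    {W_ : D} (k_ : (tensorObj Y X).X ⟶ W_) :
    quo X Y ≫ (braid X Y hX).hom.hom ≫ k_ =
      (β_ X.X Y.X).hom ≫ quo Y X ≫ k_ :=
  (reassoc_of% (quo_braid X Y hX)) k_

theorem braid_naturality_right (X : RMod M) (hX : isLocal M X) {Y Z : RMod M} (f : Y ⟶ Z) :
    tensorHom (𝟙 X) f ≫ (braid X Z hX).hom = (braid X Y hX).hom ≫ tensorHom f (𝟙 X) := by
  apply hom_ext_quo
  simp [quo_braid, quo_braid_assoc]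

theorem braid_naturality_left {X Y : RMod M} (hX : isLocal M X) (hY : isLocal M Y) (f : X ⟶ Y)
    (Z : RMod M) :
    tensorHom f (𝟙 Z) ≫ (braid Y Z hY).hom = (braid X Z hX).hom ≫ tensorHom (𝟙 Z) f := by
  apply hom_ext_quo
  simp [quo_braid, quo_braid_assoc]

theorem braid_hexagon_forward (X Y Z : RMod M) (hX : isLocal M X) :
    (associator X Y Z).hom ≫ (braid X (tensorObj Y Z) hX).hom ≫ (associator Y Z X).hom =
      tensorHom (braid X Y hX).hom (𝟙 Z) ≫ (associator Y X Z).hom ≫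
        tensorHom (𝟙 Y) (braid X Z hX).hom := by
  apply hom_ext_quo₃
  simp only [comp_hom, quo_quo_associator_assoc, quo_braid_assoc, quo_tensorHom_assoc, id_hom,
    MonoidalCategory.whiskerLeft_id, Category.id_comp,
    BraidedCategory.braiding_naturality_right_assoc, quo_quo_associator]
  rw [← comp_whiskerRight_assoc, quo_braid]
  simp only [comp_whiskerRight, Category.assoc, quo_quo_associator_assoc, quo_tensorHom, id_hom,
    id_whiskerRight, Category.id_comp]
  rw [← MonoidalCategory.whiskerLeft_comp_assoc, quo_braid]
  simp

theorem braid_hexagon_reverse (X Y Z : RMod M) (hX : isLocal M X) (hY : isLocal M Y)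
    (hXY : isLocal M (tensorObj X Y)) :
    (associator X Y Z).inv ≫ (braid (tensorObj X Y) Z hXY).hom ≫ (associator Z X Y).inv =
      tensorHom (𝟙 X) (braid Y Z hY).hom ≫ (associator X Z Y).inv ≫
        tensorHom (braid X Z hX).hom (𝟙 Y) := by
  apply hom_ext_quo
  rw [← cancel_epi (X.X ◁ quo Y Z)]
  have h (X Y Z : RMod M) {W : D} (g : (tensorObj (tensorObj X Y) Z).X ⟶ W) :
      X.X ◁ quo Y Z ≫ quo X (tensorObj Y Z) ≫ (associator X Y Z).inv.hom ≫ g =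
      (α_ X.X Y.X Z.X).inv ≫ quo X Y ▷ Z.X ≫ quo (tensorObj X Y) Z ≫ g :=
    quo_quo_assocInv_assoc X Y Z g
  have h' (X Y Z : RMod M) :
      X.X ◁ quo Y Z ≫ quo X (tensorObj Y Z) ≫ (associator X Y Z).inv.hom =
      (α_ X.X Y.X Z.X).inv ≫ quo X Y ▷ Z.X ≫ quo (tensorObj X Y) Z :=
    quo_quo_assocInv X Y Z
  simp only [comp_hom, h, quo_braid_assoc, quo_tensorHom_assoc, id_hom, id_whiskerRight,
    Category.id_comp, BraidedCategory.braiding_naturality_left_assoc, h']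
  rw [← MonoidalCategory.whiskerLeft_comp_assoc, quo_braid]
  simp only [MonoidalCategory.whiskerLeft_comp, Category.assoc, h, quo_tensorHom, id_hom,
    MonoidalCategory.whiskerLeft_id, Category.id_comp]
  rw [← comp_whiskerRight_assoc, quo_braid]
  simp

end RMod

/-- The category of local `M`-modules, a full subcategory of right `M`-modules. -/
abbrev LocMod (M : D) [MonObj M] := (RMod.isLocal M).FullSubcategory

namespace LocMod

variable (M : D) [MonObj M] [IsCommMonObj M] [HasReflexiveCoequalizers D]
  [∀ A : D, Monad.PreservesColimitOfIsReflexivePair (tensorLeft A)]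
  [∀ A : D, Monad.PreservesColimitOfIsReflexivePair (tensorRight A)]

/-- The braiding of local modules, the factorization of `Ψ_{A,B}`. -/
noncomputable instance braided : BraidedCategory (LocMod M) where
  braiding X Y := (RMod.isLocal M).isoMk (RMod.braid X.obj Y.obj X.property)
  braiding_naturality_right X _ _ f :=
    ObjectProperty.hom_ext _ (RMod.braid_naturality_right X.obj X.property f.hom)
  braiding_naturality_left f Z :=
    ObjectProperty.hom_ext _ (RMod.braid_naturality_left _ _ f.hom Z.obj)
  hexagon_forward X Y Z :=
    ObjectProperty.hom_ext _ (RMod.braid_hexagon_forward X.obj Y.obj Z.obj X.property)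
  hexagon_reverse X Y Z :=
    ObjectProperty.hom_ext _ (RMod.braid_hexagon_reverse X.obj Y.obj Z.obj X.property Y.property _)

/-- The lax monoidal functor forgetting the action. -/
abbrev forget : LocMod M ⥤ D := (RMod.isLocal M).ι ⋙ RMod.forget M

end LocMod

end Local

/-! ### Reflexive coequalizers in the Drinfeld center -/

section CenterColimits

variable {C : Type u} [Category.{v} C] [MonoidalCategory C]

instance center_isReflexivePair {X Y : Center C} (f g : X ⟶ Y) [IsReflexivePair f g] :
    IsReflexivePair f.f g.f :=
  IsReflexivePair.mk' (commonSection f g).f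
    (by rw [← Center.comp_f, section_comp_left]; rfl)
    (by rw [← Center.comp_f, section_comp_right]; rfl)

variable [∀ A : C, Monad.PreservesColimitOfIsReflexivePair (tensorLeft A)]
  [∀ A : C, Monad.PreservesColimitOfIsReflexivePair (tensorRight A)]

section

variable {X Y : C} {f g : X ⟶ Y} [IsReflexivePair f g] {Q : C} {q : Y ⟶ Q} {w : f ≫ q = g ≫ q}

theorem exists_factorR (h : IsColimit (Cofork.ofπ q w)) (U : C) {W : C} (k : Y ⊗ U ⟶ W)
    (hk : f ▷ U ≫ k = g ▷ U ≫ k) : ∃ l : Q ⊗ U ⟶ W, q ▷ U ≫ l = k :=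
  ⟨_, (Cofork.IsColimit.desc' (isColimitCoforkMapOfIsColimit (tensorRight U) w h) k hk).2⟩

theorem exists_factorL (h : IsColimit (Cofork.ofπ q w)) (U : C) {W : C} (k : U ⊗ Y ⟶ W)
    (hk : U ◁ f ≫ k = U ◁ g ≫ k) : ∃ l : U ⊗ Q ⟶ W, U ◁ q ≫ l = k :=
  ⟨_, (Cofork.IsColimit.desc' (isColimitCoforkMapOfIsColimit (tensorLeft U) w h) k hk).2⟩

theorem epi_whiskerRight (h : IsColimit (Cofork.ofπ q w)) (U : C) : Epi (q ▷ U) :=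
  ⟨fun _ _ e =>
    Cofork.IsColimit.hom_ext (isColimitCoforkMapOfIsColimit (tensorRight U) w h) e⟩

theorem epi_whiskerLeft (h : IsColimit (Cofork.ofπ q w)) (U : C) : Epi (U ◁ q) :=
  ⟨fun _ _ e =>
    Cofork.IsColimit.hom_ext (isColimitCoforkMapOfIsColimit (tensorLeft U) w h) e⟩

end

section

variable {X Y : Center C} {f g : X ⟶ Y} [IsReflexivePair f g]

theorem center_comm {Z : Center C} (q : Y ⟶ Z) (w : f ≫ q = g ≫ q)
    (h : IsColimit (Cofork.ofπ q.f (congrArg Center.Hom.f w) : Cofork f.f g.f)) {T : Center C}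
    (k : Y ⟶ T) (l : Z.1 ⟶ T.1) (e : q.f ≫ l = k.f) (U : C) :
    l ▷ U ≫ (T.2.β U).hom = (Z.2.β U).hom ≫ U ◁ l := by
  have := epi_whiskerRight h U
  rw [← cancel_epi (q.f ▷ U), ← comp_whiskerRight_assoc, e, Center.Hom.comm_assoc,
    ← MonoidalCategory.whiskerLeft_comp, e, Center.Hom.comm]

/-- A cofork in the center whose underlying cofork is a coequalizer is a coequalizer. -/
noncomputable def centerIsColimit {Z : Center C} (q : Y ⟶ Z) (w : f ≫ q = g ≫ q)
    (h : IsColimit (Cofork.ofπ q.f (congrArg Center.Hom.f w) : Cofork f.f g.f)) :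
    IsColimit (Cofork.ofπ q w) :=
  Cofork.IsColimit.mk' _ fun s => by
    have hs : f.f ≫ s.π.f = g.f ≫ s.π.f := congrArg Center.Hom.f s.condition
    refine ⟨⟨(Cofork.IsColimit.desc' h s.π.f hs).1, fun U => ?_⟩, ?_, ?_⟩
    · exact center_comm q w h s.π _ (Cofork.IsColimit.desc' h s.π.f hs).2 U
    · exact Center.ext _ _ (Cofork.IsColimit.desc' h s.π.f hs).2
    · intro m hm
      refine Center.ext _ _ (Cofork.IsColimit.hom_ext h ?_)
      have e : q.f ≫ (Cofork.IsColimit.desc' h s.π.f hs).1 = s.π.f :=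
        (Cofork.IsColimit.desc' h s.π.f hs).2
      exact (congrArg Center.Hom.f hm).trans e.symm

variable [HasReflexiveCoequalizers C] (f g)

/-- The underlying coequalizer of a reflexive pair in the center. -/
noncomputable abbrev centerQ : Y.1 ⟶ coequalizer f.f g.f := coequalizer.π f.f g.f

instance (U : C) : Epi (centerQ f g ▷ U) := epi_whiskerRight (coequalizerIsCoequalizer f.f g.f) U

instance (U V : C) : Epi (centerQ f g ▷ U ▷ V) := by
  have : centerQ f g ▷ U ▷ V = (α_ _ _ _).hom ≫ centerQ f g ▷ (U ⊗ V) ≫ (α_ _ _ _).inv := by simp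
  rw [this]; infer_instance

instance (U : C) : Epi (U ◁ centerQ f g) := epi_whiskerLeft (coequalizerIsCoequalizer f.f g.f) U

theorem exists_centerβ (U : C) : ∃ e : coequalizer f.f g.f ⊗ U ≅ U ⊗ coequalizer f.f g.f,
    centerQ f g ▷ U ≫ e.hom = (Y.2.β U).hom ≫ U ◁ centerQ f g := by
  obtain ⟨a, ha⟩ := exists_factorR (coequalizerIsCoequalizer f.f g.f) U
    ((Y.2.β U).hom ≫ U ◁ centerQ f g) (by
      rw [Center.Hom.comm_assoc, Center.Hom.comm_assoc, ← MonoidalCategory.whiskerLeft_comp,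
        ← MonoidalCategory.whiskerLeft_comp, coequalizer.condition])
  obtain ⟨b, hb⟩ := exists_factorL (coequalizerIsCoequalizer f.f g.f) U
    ((Y.2.β U).inv ≫ centerQ f g ▷ U) (by
      rw [← cancel_epi (X.2.β U).hom, ← Center.Hom.comm_assoc, ← Center.Hom.comm_assoc,
        Iso.hom_inv_id_assoc, ← comp_whiskerRight, ← comp_whiskerRight, coequalizer.condition])
  refine ⟨⟨a, b, ?_, ?_⟩, ha⟩
  · rw [← cancel_epi (centerQ f g ▷ U), reassoc_of% ha, hb]; simp
  · rw [← cancel_epi (U ◁ centerQ f g), reassoc_of% hb, ha]; simp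

/-- The half-braiding on the coequalizer. -/
noncomputable def centerβ (U : C) : coequalizer f.f g.f ⊗ U ≅ U ⊗ coequalizer f.f g.f :=
  (exists_centerβ f g U).choose

theorem centerβ_spec (U : C) :
    centerQ f g ▷ U ≫ (centerβ f g U).hom = (Y.2.β U).hom ≫ U ◁ centerQ f g :=
  (exists_centerβ f g U).choose_spec

theorem centerβ_spec_assoc (U : C)
    {W_ : C} (k_ : U ⊗ coequalizer f.f g.f ⟶ W_) :
    centerQ f g ▷ U ≫ (centerβ f g U).hom ≫ k_ =
      (Y.2.β U).hom ≫ U ◁ centerQ f g ≫ k_ :=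
  (reassoc_of% (centerβ_spec f g U)) k_

/-- The coequalizer of a reflexive pair in the center. -/
noncomputable def centerCoeq : Center C :=
  ⟨coequalizer f.f g.f,
    { β := centerβ f g
      monoidal := fun U V => by
        rw [← cancel_epi (centerQ f g ▷ (U ⊗ V)), centerβ_spec, HalfBraiding.monoidal,
          associator_inv_naturality_left_assoc, ← comp_whiskerRight_assoc, centerβ_spec]
        simp only [comp_whiskerRight, Category.assoc]
        rw [associator_naturality_middle_assoc, ← MonoidalCategory.whiskerLeft_comp_assoc,
          centerβ_spec]
        simp
      naturality := fun {U V} k => by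
        rw [← cancel_epi (centerQ f g ▷ U), ← whisker_exchange_assoc, centerβ_spec,
          HalfBraiding.naturality_assoc, centerβ_spec_assoc, whisker_exchange] }⟩

/-- The coequalizer map in the center. -/
noncomputable def centerπ : Y ⟶ centerCoeq f g := ⟨centerQ f g, centerβ_spec f g⟩

theorem centerπ_condition : f ≫ centerπ f g = g ≫ centerπ f g :=
  Center.ext _ _ (coequalizer.condition f.f g.f)

/-- The constructed cofork is a coequalizer. -/
noncomputable def centerπ_isColimit : IsColimit (Cofork.ofπ (centerπ f g) (centerπ_condition f g)) :=
  centerIsColimit _ _ (coequalizerIsCoequalizer f.f g.f)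

end

variable [HasReflexiveCoequalizers C]

instance center_hasReflexiveCoequalizers : HasReflexiveCoequalizers (Center C) where
  has_coeq _ _ f g _ := HasColimit.mk ⟨_, centerπ_isColimit f g⟩

instance center_preserves_tensorLeft (A : Center C) :
    Monad.PreservesColimitOfIsReflexivePair (tensorLeft A) where
  out {X Y} f g _ := by
    apply preservesColimit_of_preserves_colimit_cocone (centerπ_isColimit f g)
    refine (isColimitMapCoconeCoforkEquiv (tensorLeft A) (centerπ_condition f g)).symm ?_
    have : IsReflexivePair ((tensorLeft A).map f) ((tensorLeft A).map g) :=
      IsReflexivePair.mk' ((tensorLeft A).map (commonSection f g))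
        (by rw [← CategoryTheory.Functor.map_comp, section_comp_left, CategoryTheory.Functor.map_id])
        (by rw [← CategoryTheory.Functor.map_comp, section_comp_right, CategoryTheory.Functor.map_id])
    apply centerIsColimit
    exact isColimitOfHasCoequalizerOfPreservesColimit (tensorLeft A.1) f.f g.f

instance center_preserves_tensorRight (A : Center C) :
    Monad.PreservesColimitOfIsReflexivePair (tensorRight A) where
  out {X Y} f g _ := by
    apply preservesColimit_of_preserves_colimit_cocone (centerπ_isColimit f g)
    refine (isColimitMapCoconeCoforkEquiv (tensorRight A) (centerπ_condition f g)).symm ?_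
    have : IsReflexivePair ((tensorRight A).map f) ((tensorRight A).map g) :=
      IsReflexivePair.mk' ((tensorRight A).map (commonSection f g))
        (by rw [← CategoryTheory.Functor.map_comp, section_comp_left, CategoryTheory.Functor.map_id])
        (by rw [← CategoryTheory.Functor.map_comp, section_comp_right, CategoryTheory.Functor.map_id])
    apply centerIsColimit
    exact isColimitOfHasCoequalizerOfPreservesColimit (tensorRight A.1) f.f g.f

end CenterColimits

/-! ### Commutative central monoids as commutative monoids in the Drinfeld center -/

section CenterMonoid

variable {C : Type u} [Category.{v} C] [MonoidalCategory C]

/-- The monoid in `C` underlying a monoid in the Drinfeld center. -/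
instance centerMonObj (M : Center C) [MonObj M] : MonObj M.1 where
  one := Center.Hom.f (X := 𝟙_ (Center C)) η[M]
  mul := Center.Hom.f (X := M ⊗ M) μ[M]
  one_mul := congrArg Center.Hom.f (MonObj.one_mul M)
  mul_one := congrArg Center.Hom.f (MonObj.mul_one M)
  mul_assoc := congrArg Center.Hom.f (MonObj.mul_assoc M)

/-- A commutative monoid in the Drinfeld center is a commutative central monoid, with
`swap` its half-braiding. -/
instance centerCentralCommMon (M : Center C) [MonObj M] [IsCommMonObj M] :
    CentralCommMon M.1 where
  swap := M.2
  one_swap A := by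
    have h := Center.Hom.comm (X := 𝟙_ (Center C)) η[M] A
    rw [Center.tensorUnit_β] at h
    exact h.trans (Category.assoc _ _ _)
  mul_swap A := by
    have h := Center.Hom.comm (X := M ⊗ M) μ[M] A
    rw [Center.tensor_β] at h
    exact h.trans (by simp; rfl)
  swap_mul := congrArg Center.Hom.f (IsCommMonObj.mul_comm M)

/-- The `M`-module in `C` underlying a local `M`-module in the Drinfeld center. -/
def LocMod.toRMod (M : Center C) [MonObj M] : LocMod M ⥤ RMod M.1 where
  obj X :=
    { X := X.obj.X.1
      act := Center.Hom.f (X := X.obj.X ⊗ M) X.obj.act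
      act_one := congrArg Center.Hom.f X.obj.act_one
      act_mul := (congrArg Center.Hom.f X.obj.act_mul).trans (by
        rw [Center.comp_f, Center.comp_f, Center.associator_inv_f]
        rfl) }
  map f := ⟨f.hom.hom.f, congrArg Center.Hom.f f.hom.comm⟩

end CenterMonoid

/-! ### Projection formula and induced functors on Drinfeld centers -/

section Induced

open Functor.LaxMonoidal

universe v' u'

variable {C : Type u} [Category.{v} C] [MonoidalCategory C]
  {D : Type u'} [Category.{v'} D] [MonoidalCategory D] {G : C ⥤ D} {R : D ⥤ C}

/-- The left projection formula morphism `A ⊗ R X ⟶ R (G A ⊗ X)`. -/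
def lproj (adj : G ⊣ R) [R.LaxMonoidal] (A : C) (X : D) : A ⊗ R.obj X ⟶ R.obj (G.obj A ⊗ X) :=
  adj.unit.app A ▷ R.obj X ≫ Functor.LaxMonoidal.μ R (G.obj A) X

/-- The right projection formula morphism `R X ⊗ A ⟶ R (X ⊗ G A)`. -/
def rproj (adj : G ⊣ R) [R.LaxMonoidal] (X : D) (A : C) : R.obj X ⊗ A ⟶ R.obj (X ⊗ G.obj A) :=
  R.obj X ◁ adj.unit.app A ≫ Functor.LaxMonoidal.μ R X (G.obj A)

/-- The projection formula holds for `R`. -/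
structure ProjectionFormula (adj : G ⊣ R) [R.LaxMonoidal] : Prop where
  isIso_lproj : ∀ A X, IsIso (lproj adj A X)
  isIso_rproj : ∀ X A, IsIso (rproj adj X A)

/-- The composite `R X ⊗ A ⟶ R (X ⊗ G A) ⟶ R (G A ⊗ X) ⟶ A ⊗ R X` of the right projection formula
morphism, the image of the half-braiding of `X`, and the inverse of the left projection formula
morphism. -/
noncomputable def inducedβ (adj : G ⊣ R) [R.LaxMonoidal] (h : ProjectionFormula adj)
    (X : Center D) (A : C) : R.obj X.1 ⊗ A ≅ A ⊗ R.obj X.1 :=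
  haveI := h.isIso_lproj A X.1
  haveI := h.isIso_rproj X.1 A
  asIso (rproj adj X.1 A) ≪≫ R.mapIso (X.2.β (G.obj A)) ≪≫ (asIso (lproj adj A X.1)).symm

/-- The functor `(X, c) ↦ (R X, b (X, c))`, `f ↦ R f` between Drinfeld centers, for a choice `b` of
half-braidings that is compatible with the morphisms `R f`. -/
def centerFunctor (R : D ⥤ C) (b : ∀ X : Center D, HalfBraiding (R.obj X.1))
    (hb : ∀ (X Y : Center D) (f : X ⟶ Y) (A : C),
      R.map f.f ▷ A ≫ ((b Y).β A).hom = ((b X).β A).hom ≫ A ◁ R.map f.f) :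
    Center D ⥤ Center C where
  obj X := ⟨R.obj X.1, b X⟩
  map {X Y} f := ⟨R.map f.f, hb X Y f⟩
  map_id X := Center.ext _ _ (R.map_id X.1)
  map_comp f g := Center.ext _ _ (R.map_comp f.f g.f)

end Induced

end LocalModules

open LocalModules

/-! The construction of half-braidings is formal for any adjunction `G ⊣ R` with `R` lax monoidal
that satisfies the projection formula. There `R X ⊗ A ≅ R (X ⊗ G A)` and `A ⊗ R X ≅ R (G A ⊗ X)`, so
a half-braiding of `X`, evaluated at `G A`, becomes an isomorphism `R X ⊗ A ≅ A ⊗ R X`. Its hexagon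
follows from that of `X` together with naturality at the oplax map `G (A ⊗ B) ⟶ G A ⊗ G B`
(`transferβ_tensor`). Associativity and unitality of `R` make its constraints morphisms of the
center (`ε_transferβ`, `μ_transferβ`), and the triangle identity makes them braided (`μ_map_β`).

For modules, the projection formula says that `(B ⊗ M) ⊗_M X` is `B ⊗ X`, and symmetrically on the
other side. The second case uses the half-braiding of `M` to see a free right module as a free left
module.

Schauenburg's equivalence rests on one identity, `quo_β`: a half-braiding `c` of a module `X` and
the transferred one on its underlying object are intertwined by the quotient maps `X ⊗ Y ⟶ X ⊗_M Y`.
Since these are epimorphisms, `c` is determined by its transfer, and a module map respecting the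
transfers respects the half-braidings; this gives fullness. Evaluated at the unit module, the
identity says that `X` is local. Conversely, a half-braiding on a local module in the center
descends to `X ⊗_M Y ≅ Y ⊗_M X` (`IsLocalHalfBraiding.lift`), and transferring the result returns
the original half-braiding (`underlyingβ_lift`); this gives essential surjectivity.

For the monoidal structure, coequalizers in the center are detected in `C`. Hence the relative
tensor product formed in the center and the one formed in `C` are coequalizers of the same pair, and
the comparison between them inherits every coherence law from the lax braided structure of the
induced functor. -/

namespace LocalModules

/-! ### Braided lax monoidal structure on the induced functor of Drinfeld centers -/

section InducedBraided

open Functor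

universe v' u'

variable {C : Type u} [Category.{v} C] [MonoidalCategory C]
  {D : Type u'} [Category.{v'} D] [MonoidalCategory D] {G : C ⥤ D} {R : D ⥤ C}
  (adj : G ⊣ R)

/-- The unit of an adjunction, with codomain written without a composite functor. -/
def unitApp (A : C) : A ⟶ R.obj (G.obj A) := adj.unit.app A

theorem unitApp_naturality {A B : C} (g : A ⟶ B) :
    g ≫ unitApp adj B = unitApp adj A ≫ R.map (G.map g) := adj.unit.naturality g

theorem unitApp_counit (X : D) : unitApp adj (R.obj X) ≫ R.map (adj.counit.app X) = 𝟙 (R.obj X) :=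
  adj.right_triangle_components X

variable [R.LaxMonoidal]

theorem lproj_def (A : C) (X : D) :
    lproj adj A X = unitApp adj A ▷ R.obj X ≫ LaxMonoidal.μ R (G.obj A) X := rfl

theorem rproj_def (X : D) (A : C) :
    rproj adj X A = R.obj X ◁ unitApp adj A ≫ LaxMonoidal.μ R X (G.obj A) := rfl

/-! ### Naturality and associativity of the projection morphisms -/

theorem map_lproj (A : C) {X Y : D} (f : X ⟶ Y) :
    A ◁ R.map f ≫ lproj adj A Y = lproj adj A X ≫ R.map (G.obj A ◁ f) := by
  rw [lproj_def, lproj_def, whisker_exchange_assoc, LaxMonoidal.μ_natural_right, Category.assoc]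

theorem map_rproj {X Y : D} (f : X ⟶ Y) (A : C) :
    R.map f ▷ A ≫ rproj adj Y A = rproj adj X A ≫ R.map (f ▷ G.obj A) := by
  rw [rproj_def, rproj_def, ← whisker_exchange_assoc, LaxMonoidal.μ_natural_left, Category.assoc]

theorem lproj_naturality {A B : C} (g : A ⟶ B) (X : D) :
    g ▷ R.obj X ≫ lproj adj B X = lproj adj A X ≫ R.map (G.map g ▷ X) := by
  rw [lproj_def, lproj_def, ← comp_whiskerRight_assoc, unitApp_naturality,
    comp_whiskerRight_assoc, LaxMonoidal.μ_natural_left, Category.assoc]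

theorem rproj_naturality (X : D) {A B : C} (g : A ⟶ B) :
    R.obj X ◁ g ≫ rproj adj X B = rproj adj X A ≫ R.map (X ◁ G.map g) := by
  rw [rproj_def, rproj_def, ← MonoidalCategory.whiskerLeft_comp_assoc, unitApp_naturality,
    MonoidalCategory.whiskerLeft_comp_assoc, LaxMonoidal.μ_natural_right, Category.assoc]

/-- This and the next two lemmas are associativity of the lax structure with the unit of the
adjunction inserted in the last, first and middle factor respectively. Together they carry an object
of `C` past a product `R X ⊗ R Y`. -/
theorem μ_rproj (X Y : D) (A : C) :
    LaxMonoidal.μ R X Y ▷ A ≫ rproj adj (X ⊗ Y) A ≫ R.map (α_ X Y (G.obj A)).hom =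
      (α_ _ _ _).hom ≫ R.obj X ◁ rproj adj Y A ≫ LaxMonoidal.μ R X (Y ⊗ G.obj A) := by
  simp only [rproj_def, Category.assoc, MonoidalCategory.whiskerLeft_comp]
  rw [← whisker_exchange_assoc, LaxMonoidal.associativity]
  simp

theorem lproj_μ (A : C) (X Y : D) :
    lproj adj A X ▷ R.obj Y ≫ LaxMonoidal.μ R (G.obj A ⊗ X) Y ≫ R.map (α_ (G.obj A) X Y).hom =
      (α_ _ _ _).hom ≫ A ◁ LaxMonoidal.μ R X Y ≫ lproj adj A (X ⊗ Y) := by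
  simp only [lproj_def, Category.assoc, comp_whiskerRight]
  rw [whisker_exchange_assoc, LaxMonoidal.associativity]
  simp

theorem lproj_μ_rproj (X : D) (A : C) (Y : D) :
    R.obj X ◁ lproj adj A Y ≫ LaxMonoidal.μ R X (G.obj A ⊗ Y) ≫ R.map (α_ X (G.obj A) Y).inv =
      (α_ _ _ _).inv ≫ rproj adj X A ▷ R.obj Y ≫ LaxMonoidal.μ R (X ⊗ G.obj A) Y := by
  simp only [lproj_def, rproj_def, Category.assoc, comp_whiskerRight,
    MonoidalCategory.whiskerLeft_comp]
  rw [LaxMonoidal.associativity_inv]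
  simp

/-- The unit is now inserted in both outer factors; this is what lets two successive transferred
half-braidings be composed. -/
theorem lproj_rproj (A : C) (X : D) (B : C) :
    lproj adj A X ▷ B ≫ rproj adj (G.obj A ⊗ X) B ≫ R.map (α_ _ X _).hom =
      (α_ _ _ _).hom ≫ A ◁ rproj adj X B ≫ lproj adj A (X ⊗ G.obj B) := by
  rw [lproj_def, comp_whiskerRight_assoc, μ_rproj, lproj_def, whisker_exchange_assoc]
  simp

/-! ### The oplax structure of the left adjoint -/

/-- The oplax structure `G (A ⊗ B) ⟶ G A ⊗ G B` of the left adjoint of a lax monoidal functor. -/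
def leftAdjointδ (A B : C) : G.obj (A ⊗ B) ⟶ G.obj A ⊗ G.obj B :=
  (adj.homEquiv _ _).symm (unitApp adj A ▷ B ≫ rproj adj (G.obj A) B)

theorem unit_leftAdjointδ (A B : C) : unitApp adj (A ⊗ B) ≫ R.map (leftAdjointδ adj A B) =
    unitApp adj A ▷ B ≫ rproj adj (G.obj A) B := by
  have h := adj.homEquiv_unit (f := leftAdjointδ adj A B)
  rw [leftAdjointδ, Equiv.apply_symm_apply] at h
  exact h.symm

/-- Projecting out `A ⊗ B` at once agrees, up to the oplax map of `G`, with projecting out `B` and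
then `A`. The hexagon needs this and its mirror image. -/
theorem lproj_leftAdjointδ (A B : C) (X : D) :
    lproj adj (A ⊗ B) X ≫ R.map (leftAdjointδ adj A B ▷ X) ≫ R.map (α_ _ _ _).hom =
      (α_ _ _ _).hom ≫ A ◁ lproj adj B X ≫ lproj adj A (G.obj B ⊗ X) := by
  rw [lproj_def, Category.assoc, ← LaxMonoidal.μ_natural_left_assoc, ← comp_whiskerRight_assoc,
    unit_leftAdjointδ, rproj_def]
  simp only [comp_whiskerRight, Category.assoc, LaxMonoidal.associativity, lproj_def,
    MonoidalCategory.whiskerLeft_comp]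
  rw [associator_naturality_middle_assoc, associator_naturality_left_assoc,
    ← whisker_exchange_assoc, ← whisker_exchange_assoc]

theorem rproj_leftAdjointδ (X : D) (A B : C) :
    rproj adj X (A ⊗ B) ≫ R.map (X ◁ leftAdjointδ adj A B) ≫ R.map (α_ _ _ _).inv =
      (α_ _ _ _).inv ≫ rproj adj X A ▷ B ≫ rproj adj (X ⊗ G.obj A) B := by
  rw [rproj_def, Category.assoc, ← LaxMonoidal.μ_natural_right_assoc,
    ← MonoidalCategory.whiskerLeft_comp_assoc, unit_leftAdjointδ, rproj_def]
  simp only [comp_whiskerRight, Category.assoc, LaxMonoidal.associativity_inv, rproj_def,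
    MonoidalCategory.whiskerLeft_comp]
  rw [← whisker_exchange_assoc]
  simp

/-! ### Transfer of a half-braiding along the right adjoint -/

variable (h : ProjectionFormula adj)

/-- The isomorphism `inducedβ` for an unbundled half-braiding. -/
noncomputable def transferβ {X : D} (c : HalfBraiding X) (A : C) : R.obj X ⊗ A ≅ A ⊗ R.obj X :=
  inducedβ adj h ⟨X, c⟩ A

variable {X Y : D} (c : HalfBraiding X) (d : HalfBraiding Y)

/-- The inverse of `lproj` is eliminated here; later proofs cancel the isomorphism `lproj` and use
only this equation. -/
theorem transferβ_lproj (A : C) :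
    (transferβ adj h c A).hom ≫ lproj adj A X = rproj adj X A ≫ R.map (c.β (G.obj A)).hom := by
  simp [transferβ, inducedβ]

theorem transferβ_lproj_assoc (A : C) {W : C} (k : R.obj (G.obj A ⊗ X) ⟶ W) :
    (transferβ adj h c A).hom ≫ lproj adj A X ≫ k =
      rproj adj X A ≫ R.map (c.β (G.obj A)).hom ≫ k :=
  (reassoc_of% (transferβ_lproj adj h c A)) k

theorem transferβ_naturality {A B : C} (g : A ⟶ B) :
    R.obj X ◁ g ≫ (transferβ adj h c B).hom = (transferβ adj h c A).hom ≫ g ▷ R.obj X := by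
  have := h.isIso_lproj B X
  rw [← cancel_mono (lproj adj B X)]
  simp only [Category.assoc, transferβ_lproj, lproj_naturality, transferβ_lproj_assoc]
  rw [← Category.assoc, rproj_naturality, Category.assoc, ← R.map_comp, ← R.map_comp,
    HalfBraiding.naturality]

theorem map_transferβ (f : X ⟶ Y) (hf : ∀ U, f ▷ U ≫ (d.β U).hom = (c.β U).hom ≫ U ◁ f) (A : C) :
    R.map f ▷ A ≫ (transferβ adj h d A).hom = (transferβ adj h c A).hom ≫ A ◁ R.map f := by
  have := h.isIso_lproj A Y
  rw [← cancel_mono (lproj adj A Y)]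
  simp only [Category.assoc, transferβ_lproj, map_lproj, transferβ_lproj_assoc]
  rw [← Category.assoc, map_rproj, Category.assoc, ← R.map_comp, ← R.map_comp, hf]

theorem transferβ_tensor (A B : C) :
    (transferβ adj h c (A ⊗ B)).hom =
      (α_ _ _ _).inv ≫ (transferβ adj h c A).hom ▷ B ≫ (α_ _ _ _).hom ≫
        A ◁ (transferβ adj h c B).hom ≫ (α_ _ _ _).inv := by
  have := h.isIso_lproj B X
  have := h.isIso_lproj A (G.obj B ⊗ X)
  -- This composite of isomorphisms factors through `lproj` at `A ⊗ B` by `lproj_leftAdjointδ`, so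
  -- it is suited to both sides: the left uses the transfer at `A ⊗ B`, the right the transfers at
  -- `B` and `A`.
  rw [← cancel_mono ((α_ _ _ _).hom ≫ A ◁ lproj adj B X ≫ lproj adj A (G.obj B ⊗ X))]
  conv_lhs => rw [← lproj_leftAdjointδ, transferβ_lproj_assoc]
  simp only [Category.assoc, Iso.inv_hom_id_assoc]
  rw [← MonoidalCategory.whiskerLeft_comp_assoc, transferβ_lproj,
    MonoidalCategory.whiskerLeft_comp_assoc, map_lproj, ← reassoc_of% (lproj_rproj adj A X B),
    ← comp_whiskerRight_assoc, transferβ_lproj, comp_whiskerRight_assoc,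
    ← Category.assoc (R.map _ ▷ B), map_rproj, Category.assoc,
    ← reassoc_of% (rproj_leftAdjointδ adj X A B)]
  -- Both sides are now a common morphism followed by an image under `R`. What remains is naturality
  -- of `c` at the oplax map and the hexagon of `c` in `D`.
  simp only [← R.map_comp]
  rw [← HalfBraiding.naturality_assoc, HalfBraiding.monoidal]
  simp

theorem ε_transferβ (c : HalfBraiding (𝟙_ D)) (hc : ∀ U, (c.β U).hom = (λ_ U).hom ≫ (ρ_ U).inv)
    (A : C) :
    LaxMonoidal.ε R ▷ A ≫ (transferβ adj h c A).hom =
      (λ_ A).hom ≫ (ρ_ A).inv ≫ A ◁ LaxMonoidal.ε R := by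
  have := h.isIso_lproj A (𝟙_ D)
  rw [← cancel_mono (lproj adj A (𝟙_ D)), Category.assoc, transferβ_lproj, hc, R.map_comp,
    rproj_def, Category.assoc, ← whisker_exchange_assoc,
    ← LaxMonoidal.left_unitality_assoc, leftUnitor_naturality_assoc,
    ← LaxMonoidal.right_unitality_inv, rightUnitor_inv_naturality_assoc, lproj_def]
  simp only [Category.assoc, whisker_exchange_assoc]

/-- After composing with `lproj`, the object `A` is moved past `R Y` and then past `R X`. The three
associativity lemmas turn each move into the image under `R` of the corresponding factor of the
tensor product half-braiding. -/
theorem μ_transferβ (e : HalfBraiding (X ⊗ Y))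
    (he : ∀ U, (e.β U).hom = (α_ _ _ _).hom ≫ X ◁ (d.β U).hom ≫ (α_ _ _ _).inv ≫
      (c.β U).hom ▷ Y ≫ (α_ _ _ _).hom) (A : C) :
    LaxMonoidal.μ R X Y ▷ A ≫ (transferβ adj h e A).hom =
      ((α_ _ _ _).hom ≫ R.obj X ◁ (transferβ adj h d A).hom ≫ (α_ _ _ _).inv ≫
        (transferβ adj h c A).hom ▷ R.obj Y ≫ (α_ _ _ _).hom) ≫ A ◁ LaxMonoidal.μ R X Y := by
  have := h.isIso_lproj A (X ⊗ Y)
  rw [← cancel_mono (lproj adj A (X ⊗ Y))]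
  simp only [Category.assoc]
  rw [transferβ_lproj, ← lproj_μ, ← comp_whiskerRight_assoc, transferβ_lproj,
    comp_whiskerRight_assoc,
    LaxMonoidal.μ_natural_left_assoc, ← reassoc_of% (lproj_μ_rproj adj X A Y),
    ← MonoidalCategory.whiskerLeft_comp_assoc, transferβ_lproj,
    MonoidalCategory.whiskerLeft_comp_assoc, LaxMonoidal.μ_natural_right_assoc,
    ← reassoc_of% (μ_rproj adj X Y A)]
  simp only [← R.map_comp]
  rw [he]

/-! ### Compatibility with the braidings of the centers -/

/-- By the triangle identity, the unit inserted by `lproj` cancels against the counit. So the lax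
structure is recovered from the projection morphism. -/
theorem lproj_counit (Y X : D) :
    lproj adj (R.obj Y) X ≫ R.map (adj.counit.app Y ▷ X) = LaxMonoidal.μ R Y X := by
  rw [lproj_def, Category.assoc]
  erw [← LaxMonoidal.μ_natural_left]
  rw [← comp_whiskerRight_assoc, unitApp_counit]
  simp

theorem rproj_counit (X Y : D) :
    rproj adj X (R.obj Y) ≫ R.map (X ◁ adj.counit.app Y) = LaxMonoidal.μ R X Y := by
  rw [rproj_def, Category.assoc]
  erw [← LaxMonoidal.μ_natural_right]
  rw [← MonoidalCategory.whiskerLeft_comp_assoc, unitApp_counit]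
  simp

/-- Both occurrences of the lax structure are rewritten through projection morphisms at `R Y`; the
claim becomes naturality of `c` at the counit `G (R Y) ⟶ Y`. Besides giving braidedness, this ties a
half-braiding of a module to its transfer. -/
theorem μ_map_β (Y : D) :
    LaxMonoidal.μ R X Y ≫ R.map (c.β Y).hom =
      (transferβ adj h c (R.obj Y)).hom ≫ LaxMonoidal.μ R Y X := by
  rw [← rproj_counit adj, ← lproj_counit adj, transferβ_lproj_assoc, Category.assoc, ← R.map_comp]
  erw [← R.map_comp, HalfBraiding.naturality]

/-- The half-braiding on `R X` induced by a half-braiding on `X`. -/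
noncomputable def transfer : HalfBraiding (R.obj X) where
  β := transferβ adj h c
  monoidal := transferβ_tensor adj h c
  naturality := transferβ_naturality adj h c

theorem transfer_comm (X Y : Center D) (f : X ⟶ Y) (A : C) :
    R.map f.f ▷ A ≫ ((transfer adj h Y.2).β A).hom =
      ((transfer adj h X.2).β A).hom ≫ A ◁ R.map f.f :=
  map_transferβ adj h _ _ f.f f.comm A

/-- The functor between Drinfeld centers induced by a lax monoidal right adjoint that satisfies the
projection formula. -/
noncomputable abbrev inducedFunctor : Center D ⥤ Center C :=
  centerFunctor R (fun X => transfer adj h X.2) (transfer_comm adj h)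

/-- The unit constraint of the induced functor. -/
noncomputable def inducedε : 𝟙_ (Center C) ⟶ (inducedFunctor adj h).obj (𝟙_ (Center D)) where
  f := LaxMonoidal.ε R
  comm A := (ε_transferβ adj h _ (fun _ => rfl) A).trans (Category.assoc _ _ _).symm

/-- The tensor constraint of the induced functor. -/
noncomputable def inducedμ (X Y : Center D) :
    (inducedFunctor adj h).obj X ⊗ (inducedFunctor adj h).obj Y ⟶
      (inducedFunctor adj h).obj (X ⊗ Y) where
  f := LaxMonoidal.μ R X.1 Y.1
  comm := μ_transferβ adj h X.2 Y.2 _ fun _ => rfl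

/-- The lax monoidal structure of the induced functor. -/
noncomputable instance inducedLaxMonoidal : (inducedFunctor adj h).LaxMonoidal :=
  LaxMonoidal.mk (inducedε adj h) (inducedμ adj h)
    (fun f X => Center.ext _ _ (LaxMonoidal.μ_natural_left R f.f X.1))
    (fun X f => Center.ext _ _ (LaxMonoidal.μ_natural_right R X.1 f.f))
    (fun X Y Z => Center.ext _ _ (LaxMonoidal.associativity R X.1 Y.1 Z.1))
    (fun X => Center.ext _ _ (LaxMonoidal.left_unitality R X.1))
    (fun X => Center.ext _ _ (LaxMonoidal.right_unitality R X.1))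

noncomputable instance inducedLaxBraided : (inducedFunctor adj h).LaxBraided where
  braided X Y := Center.ext _ _ (μ_map_β adj h X.2 Y.1)

end InducedBraided
end LocalModules

/-! ### The projection formula for modules over a commutative central monoid -/

namespace LocalModules.RMod

variable {C : Type u} [Category.{v} C] [MonoidalCategory C] {M : C} [MonObj M]

/-- An isomorphism `q : F ⟶ B ⊗ M` of modules under which `u` corresponds to the unit of the
free-forgetful adjunction. -/
structure IsFree {B : C} (F : RMod M) (u : B ⟶ F.X) (q : F.X ⟶ B ⊗ M) : Prop where
  act_comp : F.act ≫ q = q ▷ M ≫ (α_ B M M).hom ≫ B ◁ μ[M]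
  unit_comp : u ≫ q = (ρ_ B).inv ≫ B ◁ η[M]
  comp_act : q ≫ u ▷ M ≫ F.act = 𝟙 F.X

/-- The third equation says that the free module is generated by `B`. The projection formula below
uses only the three equations, not the explicit form of the free module. -/
theorem isFree_free (B : C) :
    IsFree ((free M).obj B) (unitApp (adj M) B) (𝟙 (B ⊗ M)) where
  act_comp := by
    change ((α_ B M M).hom ≫ B ◁ μ[M]) ≫ 𝟙 (B ⊗ M) = 𝟙 (B ⊗ M) ▷ M ≫ (α_ B M M).hom ≫ B ◁ μ[M]
    simp
  unit_comp := Category.comp_id _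
  comp_act := by
    refine (Category.id_comp _).trans ?_
    change ((ρ_ B).inv ≫ B ◁ η[M]) ▷ M ≫ (α_ B M M).hom ≫ B ◁ μ[M] = 𝟙 (B ⊗ M)
    simp only [comp_whiskerRight, Category.assoc, associator_naturality_middle_assoc,
      ← MonoidalCategory.whiskerLeft_comp, MonObj.one_mul]
    simp

variable [CentralCommMon M] {B : C} {F : RMod M} {u : B ⟶ F.X} {q : F.X ⟶ B ⊗ M}

theorem whiskerLeft_lact_eq : M ◁ u ≫ lact F = (sw B).hom ≫ u ▷ M ≫ F.act := sw_nat_assoc _ _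

/-- Identified with `M ⊗ B` through the half-braiding, a free right module becomes the free left
module. Commutativity of `M` removes the swap of the two factors `M`, and compatibility of the
half-braiding with multiplication does the rest. -/
theorem IsFree.lact_comp (hF : IsFree F u q) : lact F ≫ q ≫ (sw B).inv =
    M ◁ (q ≫ (sw B).inv) ≫ (α_ M M B).inv ≫ μ[M] ▷ B := by
  have h := CentralCommMon.mul_swap (M := M) B
  rw [← Category.assoc, Iso.comp_inv_eq, lact, Category.assoc, hF.act_comp, ← sw_nat_assoc,
    sw_tensor_assoc, Iso.inv_hom_id_assoc, ← MonoidalCategory.whiskerLeft_comp,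
    CentralCommMon.swap_mul, Category.assoc, Category.assoc, h]
  simp

theorem IsFree.unit_comp_swap (hF : IsFree F u q) :
    u ≫ q ≫ (sw B).inv = (λ_ B).inv ≫ η[M] ▷ B := by
  have h := CentralCommMon.one_swap (M := M) B
  rw [← Category.assoc, Iso.comp_inv_eq, hF.unit_comp, Category.assoc, h]
  simp

variable [HasReflexiveCoequalizers C]
  [∀ A : C, Monad.PreservesColimitOfIsReflexivePair (tensorLeft A)]
  [∀ A : C, Monad.PreservesColimitOfIsReflexivePair (tensorRight A)]

theorem IsFree.isIso_whiskerRight_quo (hF : IsFree F u q) (X : RMod M) :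
    IsIso (u ▷ X.X ≫ quo F X) := by
  -- The inverse sends `b ⊗ m ⊗ x` to `b ⊗ m·x`.
  refine ⟨desc (q ▷ X.X ≫ (α_ B M X.X).hom ≫ B ◁ lact X) ?_, ?_, ?_⟩
  · rw [← comp_whiskerRight_assoc, hF.act_comp]
    simp only [comp_whiskerRight, whisker_assoc, Category.assoc, Iso.inv_hom_id_assoc,
      ← MonoidalCategory.whiskerLeft_comp, lact_mul]
    simp [whisker_exchange_assoc]
  · rw [Category.assoc, quo_desc, ← comp_whiskerRight_assoc, hF.unit_comp]
    simp [← MonoidalCategory.whiskerLeft_comp, lact_one]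
  · rw [← cancel_epi (quo F X), quo_desc_assoc, Category.assoc, Category.assoc,
      whisker_exchange_assoc]
    -- In the quotient, `m` may be moved from `x` back to the factor `F`, where `u` and the action
    -- restore the original element.
    have h' := quo_condition F X
    rw [← Iso.inv_comp_eq] at h'
    rw [← h', associator_inv_naturality_left_assoc, Iso.hom_inv_id_assoc,
      ← comp_whiskerRight_assoc, ← comp_whiskerRight_assoc, Category.assoc, hF.comp_act]
    simp

theorem IsFree.isIso_whiskerLeft_quo (hF : IsFree F u q) (X : RMod M) :
    IsIso (X.X ◁ u ≫ quo X F) := by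
  -- The inverse reads `F` as `M ⊗ B` and lets `M` act on `X` from the right; it descends because
  -- the left action on `F` is then left multiplication.
  refine ⟨desc (X.X ◁ (q ≫ (sw B).inv) ≫ (α_ X.X M B).inv ≫ X.act ▷ B) ?_, ?_, ?_⟩
  · rw [← MonoidalCategory.whiskerLeft_comp_assoc, hF.lact_comp, ← whisker_exchange_assoc,
      associator_inv_naturality_left_assoc, ← comp_whiskerRight, act_act]
    simp
  · rw [Category.assoc, quo_desc, ← MonoidalCategory.whiskerLeft_comp_assoc, hF.unit_comp_swap]
    rw [MonoidalCategory.whiskerLeft_comp_assoc, associator_inv_naturality_middle_assoc,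
      ← comp_whiskerRight, X.act_one]
    simp
  · rw [← cancel_epi (quo X F), quo_desc_assoc, Category.assoc, Category.assoc,
      ← whisker_exchange_assoc, quo_condition, associator_naturality_right_assoc,
      Iso.inv_hom_id_assoc, ← MonoidalCategory.whiskerLeft_comp_assoc,
      ← MonoidalCategory.whiskerLeft_comp_assoc, Category.assoc, whiskerLeft_lact_eq,
      Category.assoc, Iso.inv_hom_id_assoc, hF.comp_act]
    simp

variable (M) in
theorem projectionFormula : ProjectionFormula (adj M) where
  isIso_lproj B X := (isFree_free B).isIso_whiskerRight_quo X
  isIso_rproj X B := (isFree_free B).isIso_whiskerLeft_quo X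

end LocalModules.RMod

/-! ### Half-braidings on the underlying objects of modules -/

namespace LocalModules.RMod

open Functor

variable {C : Type u} [Category.{v} C] [MonoidalCategory C] {M : C} [MonObj M] [CentralCommMon M]

/-- A half-braiding on the underlying object of a module for which the action is a morphism in the
Drinfeld center and the module is local. -/
structure IsLocalHalfBraiding (X : RMod M) (d : HalfBraiding X.X) : Prop where
  central : ∀ U, X.act ▷ U ≫ (d.β U).hom = ((α_ _ _ _).hom ≫ X.X ◁ (sw U).hom ≫ (α_ _ _ _).inv ≫
    (d.β U).hom ▷ M ≫ (α_ _ _ _).hom) ≫ U ◁ X.act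
  isLocal : (d.β M).hom ≫ lact X = X.act

variable [HasReflexiveCoequalizers C]
  [∀ A : C, Monad.PreservesColimitOfIsReflexivePair (tensorLeft A)]
  [∀ A : C, Monad.PreservesColimitOfIsReflexivePair (tensorRight A)]

namespace IsLocalHalfBraiding

variable {X : RMod M} {d : HalfBraiding X.X}

/-- In `Y ⊗_M X` the action on `Y` becomes the left action on `X`. The hexagon places the
half-braiding at `M` directly before it, and locality turns the pair into the right action on `X`.
-/
theorem tensor_quo (hd : IsLocalHalfBraiding X d) (Y : RMod M) :
    (d.β (Y.X ⊗ M)).hom ≫ Y.act ▷ X.X ≫ quo Y X =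
      (α_ _ _ _).inv ≫ (d.β Y.X).hom ▷ M ≫ (α_ _ _ _).hom ≫ Y.X ◁ X.act ≫ quo Y X := by
  rw [quo_condition, HalfBraiding.monoidal]
  simp only [Category.assoc, Iso.inv_hom_id_assoc]
  rw [← MonoidalCategory.whiskerLeft_comp_assoc, hd.isLocal]

/-- Centrality moves the action of `X` past `d`. On the other side naturality moves the action of
`Y` past `d`, and `tensor_quo` identifies the results. -/
theorem desc_hom (hd : IsLocalHalfBraiding X d) (Y : RMod M) :
    X.act ▷ Y.X ≫ (d.β Y.X).hom ≫ quo Y X =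
      (α_ X.X M Y.X).hom ≫ X.X ◁ lact Y ≫ (d.β Y.X).hom ≫ quo Y X := by
  rw [reassoc_of% (hd.central Y.X), HalfBraiding.naturality_assoc, lact, comp_whiskerRight_assoc,
    ← HalfBraiding.naturality_assoc, hd.tensor_quo]

theorem desc_inv (hd : IsLocalHalfBraiding X d) (Y : RMod M) :
    Y.act ▷ X.X ≫ (d.β Y.X).inv ≫ quo X Y =
      (α_ Y.X M X.X).hom ≫ Y.X ◁ lact X ≫ (d.β Y.X).inv ≫ quo X Y := by
  -- This is centrality solved for the inverse half-braiding, so descent of the inverse needs no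
  -- further hypothesis.
  have h : (d.β Y.X).hom ▷ M ≫ (α_ _ _ _).hom ≫ Y.X ◁ X.act ≫ (d.β Y.X).inv =
      (α_ _ _ _).hom ≫ X.X ◁ (sw Y.X).inv ≫ (α_ _ _ _).inv ≫ X.act ▷ Y.X := by
    have h' := hd.central Y.X
    rw [← cancel_mono (d.β Y.X).hom]
    simp only [Category.assoc, h']
    simp
  rw [← cancel_epi (d.β (Y.X ⊗ M)).hom, ← HalfBraiding.naturality_assoc, Iso.hom_inv_id_assoc,
    HalfBraiding.monoidal]
  simp only [Category.assoc, Iso.inv_hom_id_assoc]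
  rw [← MonoidalCategory.whiskerLeft_comp_assoc, hd.isLocal, reassoc_of% h, quo_condition]
  simp [lact]

/-- The isomorphism `X ⊗_M Y ≅ Y ⊗_M X` induced by the half-braiding. -/
noncomputable def lift (hd : IsLocalHalfBraiding X d) (Y : RMod M) :
    tensorObj X Y ≅ tensorObj Y X :=
  isoMk
    { hom := desc _ (hd.desc_hom Y)
      inv := desc _ (hd.desc_inv Y)
      hom_inv_id := by rw [← cancel_epi (quo X Y)]; simp
      inv_hom_id := by rw [← cancel_epi (quo Y X)]; simp }
    (by
      dsimp only
      rw [← cancel_epi (quo X Y ▷ M), quo_act_assoc, quo_desc, ← comp_whiskerRight_assoc,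
        quo_desc]
      simp only [comp_whiskerRight, Category.assoc, quo_act]
      rw [HalfBraiding.naturality_assoc, hd.tensor_quo, Iso.hom_inv_id_assoc])

theorem quo_lift (hd : IsLocalHalfBraiding X d) (Y : RMod M) :
    quo X Y ≫ (hd.lift Y).hom.hom = (d.β Y.X).hom ≫ quo Y X :=
  quo_desc _ (hd.desc_hom Y)

theorem quo_lift_assoc (hd : IsLocalHalfBraiding X d) (Y : RMod M) {W : C}
    (k : (tensorObj Y X).X ⟶ W) :
    quo X Y ≫ (hd.lift Y).hom.hom ≫ k = (d.β Y.X).hom ≫ quo Y X ≫ k :=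
  (reassoc_of% (hd.quo_lift Y)) k

theorem lift_naturality (hd : IsLocalHalfBraiding X d) {Y Z : RMod M} (f : Y ⟶ Z) :
    tensorHom (𝟙 X) f ≫ (hd.lift Z).hom = (hd.lift Y).hom ≫ tensorHom f (𝟙 X) := by
  apply hom_ext_quo
  simp [quo_lift, quo_lift_assoc, HalfBraiding.naturality_assoc]

theorem lift_hexagon (hd : IsLocalHalfBraiding X d) (Y Z : RMod M) :
    (associator X Y Z).hom ≫ (hd.lift (tensorObj Y Z)).hom ≫ (associator Y Z X).hom =
      tensorHom (hd.lift Y).hom (𝟙 Z) ≫ (associator Y X Z).hom ≫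
        tensorHom (𝟙 Y) (hd.lift Z).hom := by
  apply hom_ext_quo₃
  simp only [comp_hom, quo_quo_associator_assoc, quo_lift_assoc, quo_tensorHom_assoc, id_hom,
    MonoidalCategory.whiskerLeft_id, Category.id_comp,
    HalfBraiding.naturality_assoc, quo_quo_associator]
  rw [← comp_whiskerRight_assoc, quo_lift]
  simp only [comp_whiskerRight, Category.assoc, quo_quo_associator_assoc, quo_tensorHom, id_hom,
    id_whiskerRight, Category.id_comp]
  rw [← MonoidalCategory.whiskerLeft_comp_assoc, quo_lift]
  simp

/-- The half-braiding on a module induced by a half-braiding on its underlying object. -/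
noncomputable def liftHalfBraiding (hd : IsLocalHalfBraiding X d) : HalfBraiding X where
  β := hd.lift
  monoidal Y Z := by
    have h := hd.lift_hexagon Y Z
    rw [← Iso.eq_inv_comp, ← Iso.eq_comp_inv] at h
    refine h.trans ?_
    rw [Category.assoc, Category.assoc, Category.assoc]
    rfl
  naturality := hd.lift_naturality

end IsLocalHalfBraiding

/-! ### Half-braidings of modules and their transfers -/

/-- The isomorphisms `X ⊗ A ≅ A ⊗ X` in `C` induced by a half-braiding on a module `X`. -/
noncomputable def underlyingβ {X : RMod M} (c : HalfBraiding X) (A : C) : X.X ⊗ A ≅ A ⊗ X.X :=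
  transferβ (adj M) (projectionFormula M) c A

theorem quo_β {X : RMod M} (c : HalfBraiding X) (Y : RMod M) :
    quo X Y ≫ (c.β Y).hom.hom = (underlyingβ c Y.X).hom ≫ quo Y X :=
  μ_map_β (adj M) (projectionFormula M) c Y

theorem quo_β_assoc {X : RMod M} (c : HalfBraiding X) (Y : RMod M) {W : C}
    (k : (tensorObj Y X).X ⟶ W) :
    quo X Y ≫ (c.β Y).hom.hom ≫ k = (underlyingβ c Y.X).hom ≫ quo Y X ≫ k :=
  (reassoc_of% (quo_β c Y)) k

/-- Precomposed with the epimorphism `quo X U`, both sides are expressed by the transferred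
half-braidings through `quo_β`. This is the fullness of Schauenburg's functor. -/
theorem β_naturality_left_of_underlyingβ {X Y : RMod M} (c : HalfBraiding X) (d : HalfBraiding Y)
    (f : X ⟶ Y)
    (hf : ∀ A, f.hom ▷ A ≫ (underlyingβ d A).hom = (underlyingβ c A).hom ≫ A ◁ f.hom)
    (U : RMod M) :
    tensorHom f (𝟙 U) ≫ (d.β U).hom = (c.β U).hom ≫ tensorHom (𝟙 U) f := by
  apply hom_ext_quo
  refine (quo_tensorHom_assoc f (𝟙 U) _).trans (Eq.trans ?_ (quo_β_assoc c U _).symm)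
  rw [id_hom, MonoidalCategory.whiskerLeft_id, Category.id_comp, quo_β, reassoc_of% (hf U.X),
    quo_tensorHom, id_hom, id_whiskerRight, Category.id_comp]

/-- The lift at the free module on `A` is induced by `d` at `A ⊗ M`. Naturality of `d` at the unit
`A ⟶ A ⊗ M` reduces this to `d` at `A`. -/
theorem IsLocalHalfBraiding.underlyingβ_lift {X : RMod M} {d : HalfBraiding X.X}
    (hd : IsLocalHalfBraiding X d) (A : C) :
    (underlyingβ hd.liftHalfBraiding A).hom = (d.β A).hom := by
  have := (projectionFormula M).isIso_lproj A X
  refine (cancel_mono (lproj (adj M) A X)).1 ((transferβ_lproj _ _ _ _).trans ?_)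
  refine (Category.assoc _ _ _).trans ?_
  refine ((X.X ◁ unitApp (adj M) A) ≫= hd.quo_lift ((free M).obj A)).trans ?_
  exact (HalfBraiding.naturality_assoc d (unitApp (adj M) A) (quo ((free M).obj A) X))

/-- The transfer for the unit module is the given half-braiding of `M`, which identifies `M` with
the image of the unit in the center. -/
theorem underlyingβ_unit (c : HalfBraiding (unit M))
    (hc : ∀ U, (c.β U).hom = (leftUnitor U).hom ≫ (rightUnitor U).inv) (A : C) :
    (underlyingβ c A).hom =
      (sw (M := M) A).hom := by
  have := (projectionFormula M).isIso_lproj A (unit M)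
  refine (cancel_mono (lproj (adj M) A (unit M))).1 ((transferβ_lproj _ _ _ _).trans ?_)
  rw [hc]
  -- The module `F` and map `u` are arbitrary: the identity compares the two unitors, that is, the
  -- left action with the right action.
  have key (F : RMod M) (u : A ⟶ F.X) :
      M ◁ u ≫ quo (unit M) F ≫ (leftUnitor F).hom.hom ≫ (rightUnitor F).inv.hom =
        (sw A).hom ≫ u ▷ M ≫ quo F (unit M) := by
    rw [quo_leftUnitor_assoc, reassoc_of% (whiskerLeft_lact_eq (u := u)), ← quo_rightUnitor,
      Category.assoc, ← comp_hom, Iso.hom_inv_id, id_hom, Category.comp_id]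
  exact (Category.assoc _ _ _).trans (key ((free M).obj A) (unitApp (adj M) A))

theorem β_unit_leftUnitor {X : RMod M} (c : HalfBraiding X) :
    (c.β (unit M)).hom ≫ (leftUnitor X).hom = (rightUnitor X).hom :=
  congrArg Center.Hom.f (braiding_leftUnitor (C := Center (RMod M)) ⟨X, c⟩)

/-- Locality comes from the half-braiding at the unit module, which intertwines the unitors. The
quotient maps turn the left and right unitors into the left and right actions. -/
theorem underlyingβ_lact {X : RMod M} (c : HalfBraiding X) :
    (underlyingβ c M).hom ≫ lact X = X.act := by
  have h := quo_β c (unit M)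
  have h' := congrArg Hom.hom (β_unit_leftUnitor c)
  rw [comp_hom] at h'
  rw [← quo_leftUnitor, ← quo_rightUnitor, ← h', reassoc_of% h]

end LocalModules.RMod

/-! ### Schauenburg's equivalence -/

namespace LocalModules

open Functor

variable {C : Type u} [Category.{v} C] [MonoidalCategory C]
  [HasReflexiveCoequalizers C]
  [∀ A : C, Monad.PreservesColimitOfIsReflexivePair (tensorLeft A)]
  [∀ A : C, Monad.PreservesColimitOfIsReflexivePair (tensorRight A)]
  (M : Center C) [MonObj M] [IsCommMonObj M]

/-- The functor between Drinfeld centers induced by the forgetful functor of modules. -/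
noncomputable abbrev centerForget : Center (RMod M.1) ⥤ Center C :=
  inducedFunctor (RMod.adj M.1) (RMod.projectionFormula M.1)

/-- The monoid `M` is the image of the unit object under `centerForget`. -/
noncomputable def toCenterForgetUnit : M ⟶ (centerForget M).obj (𝟙_ (Center (RMod M.1))) where
  f := 𝟙 M.1
  comm U := by
    have h := RMod.underlyingβ_unit (M := M.1) (𝟙_ (Center (RMod M.1))).2 (fun _ => rfl) U
    exact (id_whiskerRight M.1 U =≫ _).trans ((Category.id_comp _).trans (h.trans
      (((M.2.β U).hom ≫= MonoidalCategory.whiskerLeft_id U M.1).trans (Category.comp_id _)).symm))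

instance isIso_toCenterForgetUnit : IsIso (toCenterForgetUnit M) :=
  have : IsIso (toCenterForgetUnit M).f := inferInstanceAs (IsIso (𝟙 M.1))
  Center.isIso_of_f_isIso _

variable {M}

/-- The action of `M` on the image of a central module, as a morphism in the Drinfeld center. -/
noncomputable def centerAct (X : Center (RMod M.1)) :
    (centerForget M).obj X ⊗ M ⟶ (centerForget M).obj X where
  f := X.1.act
  comm U := by
    -- The action is the lax structure at `X` and the unit followed by the right unitor, all of
    -- which are morphisms in the center. Its centrality is therefore that of a composite.
    have h := (((centerForget M).obj X ◁ toCenterForgetUnit M) ≫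
      LaxMonoidal.μ (centerForget M) X (𝟙_ _) ≫ (centerForget M).map (ρ_ X).hom).comm U
    have e : (((centerForget M).obj X ◁ toCenterForgetUnit M) ≫
      LaxMonoidal.μ (centerForget M) X (𝟙_ _) ≫ (centerForget M).map (ρ_ X).hom).f = X.1.act := by
      exact (MonoidalCategory.whiskerLeft_id X.1.X M.1 =≫
        (RMod.quo X.1 (RMod.unit M.1) ≫ (RMod.rightUnitor X.1).hom.hom)).trans
          ((Category.id_comp _).trans (RMod.quo_rightUnitor X.1))
    rw [e] at h
    exact h

/-- The module in the Drinfeld center underlying a central module. -/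
noncomputable def centerMod (X : Center (RMod M.1)) : RMod M where
  X := (centerForget M).obj X
  act := centerAct X
  act_one := Center.ext _ _ X.1.act_one
  act_mul := Center.ext _ _ (X.1.act_mul.trans (by
    rw [Center.comp_f, Center.comp_f, Center.associator_inv_f]
    rfl))

variable (M)

/-- Schauenburg's functor from the Drinfeld center of modules to local modules in the Drinfeld
center. -/
noncomputable def schauenburg : Center (RMod M.1) ⥤ LocMod M where
  -- The equation from `underlyingβ_lact` is exactly locality, since the braiding of the center at
  -- `M` is the transferred half-braiding.
  obj X := ⟨centerMod X, Center.ext _ _ (RMod.underlyingβ_lact X.2)⟩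
  map f := ObjectProperty.homMk
    ⟨(centerForget M).map f, Center.ext _ _ (RMod.hom_comm f.f)⟩
  map_id _ := ObjectProperty.hom_ext _ (RMod.hom_ext ((centerForget M).map_id _))
  map_comp _ _ := ObjectProperty.hom_ext _ (RMod.hom_ext ((centerForget M).map_comp _ _))

instance : (schauenburg M).Faithful where
  map_injective {X Y _ _} h := Center.ext _ _ (RMod.hom_ext
    (congrArg (fun k : (schauenburg M).obj X ⟶ (schauenburg M).obj Y => k.hom.hom.f) h))

instance : (schauenburg M).Full where
  map_surjective {X Y} k := by
    exact ⟨⟨⟨k.hom.hom.f, congrArg Center.Hom.f k.hom.comm⟩,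
      RMod.β_naturality_left_of_underlyingβ X.2 Y.2 _ k.hom.hom.comm⟩, rfl⟩

/-- The half-braiding of a local module in the Drinfeld center. -/
theorem LocMod.isLocalHalfBraiding (L : LocMod M) :
    RMod.IsLocalHalfBraiding ((LocMod.toRMod M).obj L) L.obj.X.2 where
  central U := L.obj.act.comm U
  isLocal := congrArg Center.Hom.f L.property

/-- The central module corresponding to a local module in the Drinfeld center. -/
noncomputable def LocMod.toCenter (L : LocMod M) : Center (RMod M.1) :=
  ⟨(LocMod.toRMod M).obj L, L.isLocalHalfBraiding.liftHalfBraiding⟩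

end LocalModules

/-! ### Essential surjectivity -/

namespace LocalModules

open Functor

/-- A morphism compatible with two coequalizer maps of the same pair is an isomorphism. -/
theorem isIso_of_isColimit_cofork {C : Type u} [Category.{v} C] {A B Q Q' : C} {f g : A ⟶ B}
    {q : B ⟶ Q} {q' : B ⟶ Q'} {w : f ≫ q = g ≫ q} {w' : f ≫ q' = g ≫ q'}
    (h : IsColimit (Cofork.ofπ q w)) (h' : IsColimit (Cofork.ofπ q' w')) (k : Q ⟶ Q')
    (hk : q ≫ k = q') : IsIso k := by
  obtain ⟨l, hl⟩ := Cofork.IsColimit.desc' h' q w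
  have hl' : q' ≫ l = q := hl
  refine ⟨l, Cofork.IsColimit.hom_ext h ?_, Cofork.IsColimit.hom_ext h' ?_⟩
  · change q ≫ k ≫ l = q ≫ 𝟙 _
    rw [reassoc_of% hk, hl', Category.comp_id]
  · change q' ≫ l ≫ k = q' ≫ 𝟙 _
    rw [reassoc_of% hl', hk, Category.comp_id]

theorem RMod.isIso_of_isColimit {C : Type u} [Category.{v} C] [MonoidalCategory C]
    [HasReflexiveCoequalizers C]
    [∀ A : C, Monad.PreservesColimitOfIsReflexivePair (tensorLeft A)]
    [∀ A : C, Monad.PreservesColimitOfIsReflexivePair (tensorRight A)]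
    {M : C} [MonObj M] [CentralCommMon M] {X Y : RMod M} {Q : C} {q : X.X ⊗ Y.X ⟶ Q}
    {w : left X Y ≫ q = right X Y ≫ q} (h : IsColimit (Cofork.ofπ q w))
    (k : (tensorObj X Y).X ⟶ Q) (hk : quo X Y ≫ k = q) : IsIso k :=
  isIso_of_isColimit_cofork (coequalizerIsCoequalizer (left X Y) (right X Y)) h k hk

variable {C : Type u} [Category.{v} C] [MonoidalCategory C]
  [HasReflexiveCoequalizers C]
  [∀ A : C, Monad.PreservesColimitOfIsReflexivePair (tensorLeft A)]
  [∀ A : C, Monad.PreservesColimitOfIsReflexivePair (tensorRight A)]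
  {M : Center C} [MonObj M] [IsCommMonObj M]

/-- A local module is isomorphic to the image of the corresponding central module. -/
noncomputable def toCenterIso (L : LocMod M) : (schauenburg M).obj (LocMod.toCenter M L) ≅ L :=
  -- The underlying objects and actions coincide, so only the half-braidings need comparison;
  -- `underlyingβ_lift` says that they agree.
  let g : (centerForget M).obj (LocMod.toCenter M L) ⟶ L.obj.X :=
    { f := 𝟙 L.obj.X.1
      comm := fun U => (id_whiskerRight L.obj.X.1 U =≫ _).trans ((Category.id_comp _).trans
        ((L.isLocalHalfBraiding.underlyingβ_lift U).symm.trans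
        ((_ ≫= MonoidalCategory.whiskerLeft_id U L.obj.X.1).trans (Category.comp_id _)).symm)) }
  (RMod.isLocal M).isoMk (RMod.isoMk
    (@Center.isoMk _ _ _ _ _ g (inferInstanceAs (IsIso (𝟙 L.obj.X.1)))) (Center.ext _ _
    ((Category.comp_id (Center.Hom.f (X := L.obj.X ⊗ M) L.obj.act)).trans
      ((id_whiskerRight L.obj.X.1 M.1 =≫ _).trans (Category.id_comp _)).symm)))

variable (M) in
instance : (schauenburg M).EssSurj where
  mem_essImage L := ⟨_, ⟨toCenterIso L⟩⟩

variable (M) in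
instance : (schauenburg M).IsEquivalence where

/-! ### The braided monoidal structure of Schauenburg's equivalence -/

/-- The tensor constraint of `centerForget`, as a morphism between underlying objects of modules in
the Drinfeld center. -/
noncomputable def centerQuo (X Y : Center (RMod M.1)) :
    (centerMod X).X ⊗ (centerMod Y).X ⟶ (centerMod (X ⊗ Y)).X :=
  LaxMonoidal.μ (centerForget M) X Y

theorem centerQuo_condition (X Y : Center (RMod M.1)) :
    (centerMod X).act ▷ (centerMod Y).X ≫ centerQuo X Y =
      (α_ (centerMod X).X M (centerMod Y).X).hom ≫ (centerMod X).X ◁ RMod.lact (centerMod Y) ≫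
        centerQuo X Y :=
  Center.ext _ _ (RMod.quo_condition X.1 Y.1)

theorem left_centerQuo (X Y : Center (RMod M.1)) :
    RMod.left (centerMod X) (centerMod Y) ≫ centerQuo X Y =
      RMod.right (centerMod X) (centerMod Y) ≫ centerQuo X Y :=
  (centerQuo_condition X Y).trans (Category.assoc _ _ _).symm

/-- The tensor constraint of `centerForget` is a coequalizer of module actions. -/
noncomputable def isColimitCenterQuo (X Y : Center (RMod M.1)) :
    IsColimit (Cofork.ofπ (centerQuo X Y) (left_centerQuo X Y)) :=
  haveI := RMod.isReflexivePair (centerMod X) (centerMod Y)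
  -- The pair in the center lies over the pair defining `X ⊗_M Y` in `C`, and a coequalizer there
  -- lifts to the center.
  centerIsColimit _ _ (coequalizerIsCoequalizer (RMod.left X.1 Y.1) (RMod.right X.1 Y.1))

/-- The comparison of the relative tensor products over `M` and over its underlying monoid. -/
noncomputable def comparison (X Y : Center (RMod M.1)) :
    RMod.tensorObj (centerMod X) (centerMod Y) ⟶ centerMod (X ⊗ Y) where
  hom := RMod.desc (centerQuo X Y) (centerQuo_condition X Y)
  comm := by
    rw [← cancel_epi (RMod.quo (centerMod X) (centerMod Y) ▷ M), RMod.quo_act_assoc,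
      RMod.quo_desc, ← comp_whiskerRight_assoc, RMod.quo_desc]
    exact Center.ext _ _ (RMod.quo_act X.1 Y.1).symm

theorem quo_comparison (X Y : Center (RMod M.1)) :
    RMod.quo (centerMod X) (centerMod Y) ≫ (comparison X Y).hom = centerQuo X Y :=
  RMod.quo_desc _ (centerQuo_condition X Y)

instance (X Y : Center (RMod M.1)) : IsIso (comparison X Y).hom :=
  RMod.isIso_of_isColimit (isColimitCenterQuo X Y) _ (quo_comparison X Y)

/-- The comparison of relative tensor products is an isomorphism. -/
noncomputable def comparisonIso (X Y : Center (RMod M.1)) :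
    RMod.tensorObj (centerMod X) (centerMod Y) ≅ centerMod (X ⊗ Y) :=
  RMod.isoMk (asIso (comparison X Y).hom) (comparison X Y).comm

theorem quo_comparisonIso (X Y : Center (RMod M.1)) :
    RMod.quo (centerMod X) (centerMod Y) ≫ (comparisonIso X Y).hom.hom = centerQuo X Y :=
  quo_comparison X Y

theorem quo_comparisonIso_assoc (X Y : Center (RMod M.1)) {W : Center C}
    (k : (centerMod (X ⊗ Y)).X ⟶ W) :
    RMod.quo (centerMod X) (centerMod Y) ≫ (comparisonIso X Y).hom.hom ≫ k = centerQuo X Y ≫ k :=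
  (reassoc_of% (quo_comparisonIso X Y)) k

/-- The action of Schauenburg's functor on morphisms. -/
noncomputable def centerModMap {X Y : Center (RMod M.1)} (f : X ⟶ Y) : centerMod X ⟶ centerMod Y :=
  ((schauenburg M).map f).hom

/-- The unit object of modules in the Drinfeld center corresponds to the central unit module. -/
noncomputable def unitIso : RMod.unit M ≅ centerMod (𝟙_ (Center (RMod M.1))) :=
  RMod.isoMk (@asIso _ _ _ _ (toCenterForgetUnit M) (isIso_toCenterForgetUnit M)) (Center.ext _ _
    ((Category.comp_id (X := M.1 ⊗ M.1) μ[M.1]).trans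
      ((id_whiskerRight M.1 M.1 =≫ _).trans (Category.id_comp _)).symm))

/-! ### Coherence of the comparison isomorphisms -/

/-- Precomposing with `quo` replaces the comparison by the lax structure of `centerForget`.
Naturality and associativity thereby become the corresponding lax monoidal axioms. -/
theorem comparisonIso_natural_left {X Y : Center (RMod M.1)} (f : X ⟶ Y)
    (Z : Center (RMod M.1)) :
    RMod.tensorHom (centerModMap f) (𝟙 (centerMod Z)) ≫ (comparisonIso Y Z).hom =
      (comparisonIso X Z).hom ≫ centerModMap (f ▷ Z) := by
  apply RMod.hom_ext_quo
  rw [RMod.comp_hom, RMod.quo_tensorHom_assoc, RMod.comp_hom, quo_comparisonIso_assoc,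
    quo_comparisonIso, RMod.id_hom, MonoidalCategory.whiskerLeft_id, Category.id_comp]
  exact LaxMonoidal.μ_natural_left (centerForget M) f Z

theorem comparisonIso_natural_right {X Y : Center (RMod M.1)} (Z : Center (RMod M.1))
    (f : X ⟶ Y) :
    RMod.tensorHom (𝟙 (centerMod Z)) (centerModMap f) ≫ (comparisonIso Z Y).hom =
      (comparisonIso Z X).hom ≫ centerModMap (Z ◁ f) := by
  apply RMod.hom_ext_quo
  rw [RMod.comp_hom, RMod.quo_tensorHom_assoc, RMod.comp_hom, quo_comparisonIso_assoc,
    quo_comparisonIso, RMod.id_hom, id_whiskerRight, Category.id_comp]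
  exact LaxMonoidal.μ_natural_right (centerForget M) Z f

theorem comparisonIso_associativity (X Y Z : Center (RMod M.1)) :
    RMod.tensorHom (comparisonIso X Y).hom (𝟙 (centerMod Z)) ≫ (comparisonIso (X ⊗ Y) Z).hom ≫
        centerModMap (α_ X Y Z).hom =
      (RMod.associator _ _ _).hom ≫ RMod.tensorHom (𝟙 (centerMod X)) (comparisonIso Y Z).hom ≫
        (comparisonIso X (Y ⊗ Z)).hom := by
  apply RMod.hom_ext_quo₃
  simp only [RMod.comp_hom]
  rw [RMod.quo_quo_associator_assoc, RMod.quo_tensorHom_assoc, RMod.quo_tensorHom_assoc,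
    ← comp_whiskerRight_assoc, quo_comparisonIso, quo_comparisonIso_assoc, quo_comparisonIso,
    RMod.id_hom, RMod.id_hom, MonoidalCategory.whiskerLeft_id, Category.id_comp, id_whiskerRight,
    Category.id_comp, ← MonoidalCategory.whiskerLeft_comp_assoc, quo_comparisonIso]
  exact LaxMonoidal.associativity (centerForget M) X Y Z

/-- After precomposition with `quo` and passage to `C`, both sides are the left action, because
`unitIso` is the identity on underlying objects. -/
theorem comparisonIso_left_unitality (X : Center (RMod M.1)) :
    (RMod.leftUnitor (centerMod X)).hom = RMod.tensorHom unitIso.hom (𝟙 (centerMod X)) ≫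
      (comparisonIso (𝟙_ _) X).hom ≫ centerModMap (λ_ X).hom := by
  apply RMod.hom_ext_quo
  simp only [RMod.comp_hom]
  rw [RMod.quo_leftUnitor, RMod.quo_tensorHom_assoc, quo_comparisonIso_assoc, RMod.id_hom,
    MonoidalCategory.whiskerLeft_id, Category.id_comp]
  exact Center.ext _ _ ((RMod.quo_leftUnitor X.1).symm.trans
    ((id_whiskerRight M.1 X.1.X =≫
      (RMod.quo (RMod.unit M.1) X.1 ≫ (RMod.leftUnitor X.1).hom.hom)).trans
      (Category.id_comp _)).symm)

theorem comparisonIso_right_unitality (X : Center (RMod M.1)) :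
    (RMod.rightUnitor (centerMod X)).hom = RMod.tensorHom (𝟙 (centerMod X)) unitIso.hom ≫
      (comparisonIso X (𝟙_ _)).hom ≫ centerModMap (ρ_ X).hom := by
  apply RMod.hom_ext_quo
  simp only [RMod.comp_hom]
  rw [RMod.quo_rightUnitor, RMod.quo_tensorHom_assoc, quo_comparisonIso_assoc, RMod.id_hom,
    id_whiskerRight, Category.id_comp]
  exact Center.ext _ _ ((RMod.quo_rightUnitor X.1).symm.trans
    ((MonoidalCategory.whiskerLeft_id X.1.X M.1 =≫
      (RMod.quo X.1 (RMod.unit M.1) ≫ (RMod.rightUnitor X.1).hom.hom)).trans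
      (Category.id_comp _)).symm)

/-- The braiding of local modules is induced by that of the center, so the claim reduces to
`centerForget` being lax braided. -/
theorem comparisonIso_braid (X Y : Center (RMod M.1)) (hX : RMod.isLocal M (centerMod X)) :
    (comparisonIso X Y).hom ≫ centerModMap (β_ X Y).hom =
      (RMod.braid _ _ hX).hom ≫ (comparisonIso Y X).hom := by
  apply RMod.hom_ext_quo
  rw [RMod.comp_hom, RMod.comp_hom, quo_comparisonIso_assoc, RMod.quo_braid_assoc,
    quo_comparisonIso]
  exact LaxBraided.braided (F := centerForget M) X Y

variable (M)

/-- The monoidal structure of Schauenburg's functor. -/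
noncomputable instance schauenburgMonoidal : (schauenburg M).Monoidal :=
  CoreMonoidal.toMonoidal
    { εIso := (RMod.isLocal M).isoMk unitIso
      μIso := fun X Y => (RMod.isLocal M).isoMk (comparisonIso X Y)
      μIso_hom_natural_left := fun f Z =>
        ObjectProperty.hom_ext _ (comparisonIso_natural_left f Z)
      μIso_hom_natural_right := fun Z f =>
        ObjectProperty.hom_ext _ (comparisonIso_natural_right Z f)
      associativity := fun X Y Z => ObjectProperty.hom_ext _ (comparisonIso_associativity X Y Z)
      left_unitality := fun X => ObjectProperty.hom_ext _ (comparisonIso_left_unitality X)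
      right_unitality := fun X => ObjectProperty.hom_ext _ (comparisonIso_right_unitality X) }

noncomputable instance schauenburgBraided : (schauenburg M).Braided where
  braided X Y := ObjectProperty.hom_ext _
    (comparisonIso_braid X Y ((schauenburg M).obj X).property)

/-- Schauenburg's functor preserves underlying modules. -/
noncomputable def schauenburgToRMod : schauenburg M ⋙ LocMod.toRMod M ≅ Center.forget (RMod M.1) :=
  NatIso.ofComponents (fun X => RMod.isoMk (Iso.refl X.1.X)
    ((Category.comp_id _).trans ((id_whiskerRight X.1.X M.1 =≫ _).trans (Category.id_comp _)).symm))
    fun _ => RMod.hom_ext ((Category.comp_id _).trans (Category.id_comp _).symm)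

/-- Under Schauenburg's functor, forgetting the action corresponds to `centerForget`. -/
noncomputable def schauenburgForget : schauenburg M ⋙ LocMod.forget M ≅ centerForget M :=
  NatIso.ofComponents (fun X => Iso.refl ((centerForget M).obj X))
    fun f => (Category.comp_id ((centerForget M).map f)).trans
      (Category.id_comp ((centerForget M).map f)).symm

/-- All components are identities, so only the structure maps are compared: the unit of `M` with
that of `centerForget`, and `quo` followed by the comparison with `centerQuo`. -/
instance isMonoidal_schauenburgForget : NatTrans.IsMonoidal (schauenburgForget M).hom where
  unit := by
    refine (Category.comp_id _).trans ?_
    change (η[M] ≫ 𝟙 M) ≫ toCenterForgetUnit M = LaxMonoidal.ε (centerForget M)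
    rw [Category.comp_id]
    exact Center.ext _ _ (Category.comp_id _)
  tensor X Y := by
    refine (Category.comp_id _).trans ?_
    change (RMod.quo (centerMod X) (centerMod Y) ≫ 𝟙 _) ≫ (comparisonIso X Y).hom.hom =
      (𝟙 (centerMod X).X ⊗ₘ 𝟙 (centerMod Y).X) ≫ centerQuo X Y
    rw [Category.comp_id, quo_comparisonIso, id_tensorHom_id, Category.id_comp]

end LocalModules

theorem mainTheorem7 {C : Type u} [Category.{v} C] [MonoidalCategory C]
    [HasReflexiveCoequalizers C]
    [∀ A : C, Monad.PreservesColimitOfIsReflexivePair (tensorLeft A)]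
    [∀ A : C, Monad.PreservesColimitOfIsReflexivePair (tensorRight A)]
    (M : Center C) [MonObj M] [IsCommMonObj M] :
    ∃ (hproj : ProjectionFormula (RMod.adj M.1))
      (b : ∀ X : Center (RMod M.1), HalfBraiding ((RMod.forget M.1).obj X.1))
      (_ : ∀ X A, (b X).β A = inducedβ (RMod.adj M.1) hproj X A)
      (hb : ∀ (X Y : Center (RMod M.1)) (f : X ⟶ Y) (A : C),
        (RMod.forget M.1).map f.f ▷ A ≫ ((b Y).β A).hom =
          ((b X).β A).hom ≫ A ◁ (RMod.forget M.1).map f.f)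
      (_ : (centerFunctor (RMod.forget M.1) b hb).LaxBraided),
      (Functor.LaxMonoidal.ε (centerFunctor (RMod.forget M.1) b hb)).f =
          Functor.LaxMonoidal.ε (RMod.forget M.1) ∧
      (∀ X Y : Center (RMod M.1),
        (Functor.LaxMonoidal.μ (centerFunctor (RMod.forget M.1) b hb) X Y).f =
          Functor.LaxMonoidal.μ (RMod.forget M.1) X.1 Y.1) ∧
      ∃ (S : Center (RMod M.1) ≌ LocMod M) (_ : S.functor.Braided)
        (φ : S.functor ⋙ LocMod.toRMod M ≅ Center.forget (RMod M.1))
        (ψ : S.functor ⋙ LocMod.forget M ≅ centerFunctor (RMod.forget M.1) b hb),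
        NatTrans.IsMonoidal ψ.hom ∧
        ∀ X : Center (RMod M.1), (ψ.hom.app X).f = (φ.hom.app X).hom :=
  ⟨RMod.projectionFormula M.1, fun X => transfer _ _ X.2, fun _ _ => rfl, transfer_comm _ _,
    -- The constraints of the induced functor were built with those of the forgetful functor as
    -- underlying morphisms. The final `rfl` holds because `φ` and `ψ` both consist of identities in
    -- `C`.
    inducedLaxBraided _ _, rfl, fun _ _ => rfl, (schauenburg M).asEquivalence,
    schauenburgBraided M, schauenburgToRMod M, schauenburgForget M, isMonoidal_schauenburgForget M,
    fun _ => rfl⟩
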